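/- Let $R$ be a rational self-map of the Riemann sphere $\widehat{\mathbb C}$ of degree at least $2$. Let $J$ be its Julia set, that is, the complement of the set of points having a neighbourhood on which the iterates $R^n$ form a normal family. Let $C_R$ be the group of homeomorphisms $f:J\to J$ with $f\circ R=R\circ f$ on $J$, with the compact-open topology. Then $J$ contains periodic points of $R$. Let $p\ge 1$ be the lowest period of a periodic point in $J$, let $A_1=\{z\in J: R^p(z)=z\}$, and for $n\ge 1$ let $A_{n+1}=R^{-1}(A_n)\cup A_n$. The sets $A_n$ are nonempty finite subsets of $J$, and $\overline{\bigcup_{n\ge 1}A_n}=J$. Let $B_n$ be the finite group (with the discrete topology) of those permutations of $A_n$ that preserve $A_k$ for every $k\le n$. With the restriction homomorphisms $B_m\to B_n$ ($m\ge n$), the groups $B_n$ form an inverse system. Its inverse limit $B_\infty\subset\prod_n B_n$, with the topology induced by the product topology, is a totally disconnected topological group (a Cantor group). Moreover $g(A_n)=A_n$ for all $g\in C_R$ and all $n$, and the map $C_R\to B_\infty$, $g\mapsto (g|_{A_n})_{n\ge 1}$, is a continuous injective group homomorphism. Corollary: the topological group $C_R$ is totally disconnected as a space, and a topological conjugacy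 from $R$ to another rational map is unique on $J$ up to an element of $C_R$. That is, if $S$ is a rational map and $\varphi,\psi:\widehat{\mathbb C}\to\widehat{\mathbb C}$ are homeomorphisms with $\varphi R=S\varphi$ and $\psi R=S\psi$, then $\varphi$ and $\psi$ both map $J$ onto the Julia set of $S$, and there is exactly one $g\in C_R$ with $\varphi=\psi\circ g$ on $J$. -/

import Mathlib

open Set Filter Topology

noncomputable section

namespace RationalDynamics

/-! ## The Riemann sphere and rational maps -/

/-- The Riemann sphere `ℂ ∪ {∞}`, with the topology of the one-point compactification. -/
abbrev Sphere : Type := OnePoint ℂ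

/-- The chordal metric on the sphere: the Euclidean distance of the stereographic images. -/
def chordalDist : Sphere → Sphere → ℝ
  | some z, some w => 2 * ‖z - w‖ / (√(1 + ‖z‖ ^ 2) * √(1 + ‖w‖ ^ 2))
  | some z, none => 2 / √(1 + ‖z‖ ^ 2)
  | none, some w => 2 / √(1 + ‖w‖ ^ 2)
  | none, none => 0

/-- The point `a / b` of the sphere, for `(a, b) ≠ (0, 0)`: it is `∞` when `b = 0`. -/
def ratio (a b : ℂ) : Sphere := if b = 0 then OnePoint.infty else ((a / b : ℂ) : Sphere)

/-- The degree of a rational function `P / Q` in lowest terms: `max (deg P) (deg Q)`. -/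
def degree (R : RatFunc ℂ) : ℕ := max R.num.natDegree R.denom.natDegree

/-- The self-map of the sphere given by a rational function `P / Q` in lowest terms. The value at
`∞` is the ratio of the coefficients of `P` and `Q` in degree `max (deg P) (deg Q)`. -/
def ratMap (R : RatFunc ℂ) : Sphere → Sphere
  | some z => ratio (R.num.eval z) (R.denom.eval z)
  | none => ratio (R.num.coeff (degree R)) (R.denom.coeff (degree R))

theorem tendsto_ratio {α : Type*} {l : Filter α} {a b : α → ℂ} {A B : ℂ}
    (ha : Tendsto a l (𝓝 A)) (hb : Tendsto b l (𝓝 B)) (h : A ≠ 0 ∨ B ≠ 0) :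
    Tendsto (fun x => ratio (a x) (b x)) l (𝓝 (ratio A B)) := by
  by_cases hB : B = 0
  · have hA : A ≠ 0 := h.resolve_right (fun h' => h' hB)
    subst hB
    have hlim : ratio A 0 = OnePoint.infty := by simp [ratio]
    rw [hlim]
    intro S hS
    rw [OnePoint.nhds_infty_eq, mem_sup, mem_map, mem_pure, coclosedCompact_eq_cocompact,
      ← Metric.cobounded_eq_cocompact] at hS
    obtain ⟨hS1, hS2⟩ := hS
    have hinv : ∀ᶠ w in 𝓝[≠] (0 : ℂ), ((w⁻¹ : ℂ) : Sphere) ∈ S :=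
      tendsto_inv₀_nhdsNE_zero.eventually hS1
    rw [eventually_nhdsWithin_iff] at hinv
    have hq : Tendsto (fun x => b x / a x) l (𝓝 0) := by
      have := hb.div ha hA
      rwa [zero_div] at this
    change ∀ᶠ x in l, ratio (a x) (b x) ∈ S
    filter_upwards [hq.eventually hinv, ha.eventually_ne hA] with x hx hax
    by_cases hbx : b x = 0
    · simpa [ratio, hbx] using hS2
    · have := hx (by simpa using ⟨hbx, hax⟩)
      simpa [ratio, hbx] using this
  · have hlim : ratio A B = ((A / B : ℂ) : Sphere) := by simp [ratio, hB]
    rw [hlim]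
    refine ((OnePoint.continuous_coe.tendsto _).comp (ha.div hb hB)).congr' ?_
    filter_upwards [hb.eventually_ne hB] with x hx
    simp [ratio, hx]

theorem tendsto_eval_div_pow (P : Polynomial ℂ) {d : ℕ} (hd : P.natDegree ≤ d) :
    Tendsto (fun z : ℂ => P.eval z / z ^ d) (Bornology.cobounded ℂ) (𝓝 (P.coeff d)) := by
  have h0 : (P.reflect d).eval 0 = P.coeff d := by
    rw [← Polynomial.coeff_zero_eq_eval_zero, Polynomial.coeff_reflect]
    simp [Polynomial.revAt_le]
  have h1 : Tendsto (fun z : ℂ => (P.reflect d).eval z⁻¹) (Bornology.cobounded ℂ)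
      (𝓝 (P.coeff d)) := by
    rw [← h0]
    exact ((P.reflect d).continuous.tendsto 0).comp tendsto_inv₀_cobounded
  refine h1.congr' ?_
  filter_upwards [Bornology.eventually_ne_cobounded (0 : ℂ)] with z hz
  let _ := invertibleOfNonzero hz
  have := Polynomial.eval₂_reflect_mul_pow (RingHom.id ℂ) z d P hd
  rw [invOf_eq_inv] at this
  rw [eq_div_iff (pow_ne_zero _ hz)]
  exact this

theorem continuous_ratMap (R : RatFunc ℂ) : Continuous (ratMap R) := by
  rw [continuous_iff_continuousAt]
  intro x
  induction x using OnePoint.rec with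
  | infty =>
    rw [OnePoint.continuousAt_infty', coclosedCompact_eq_cocompact,
      ← Metric.cobounded_eq_cocompact]
    have hne : R.num.coeff (degree R) ≠ 0 ∨ R.denom.coeff (degree R) ≠ 0 := by
      have hden : R.denom.coeff R.denom.natDegree ≠ 0 :=
        Polynomial.leadingCoeff_ne_zero.mpr R.denom_ne_zero
      rcases le_total R.num.natDegree R.denom.natDegree with h | h
      · right
        simpa [degree, max_eq_right h] using hden
      · rcases eq_or_ne R.num 0 with h0 | h0
        · right
          have : R.denom.natDegree = 0 := by simpa [h0] using h
          rw [this] at hden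
          simpa [degree, h0, this] using hden
        · left
          simpa [degree, max_eq_left h] using h0
    refine (tendsto_ratio (tendsto_eval_div_pow R.num (le_max_left _ _))
      (tendsto_eval_div_pow R.denom (le_max_right _ _)) hne).congr' ?_
    filter_upwards [Bornology.eventually_ne_cobounded (0 : ℂ)] with z hz
    have hp := pow_ne_zero (degree R) hz
    change ratio _ _ = ratio (R.num.eval z) (R.denom.eval z)
    unfold ratio
    change (if R.denom.eval z / z ^ degree R = 0 then _ else
      ((R.num.eval z / z ^ degree R / (R.denom.eval z / z ^ degree R) : ℂ) : Sphere)) = _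
    rw [div_div_div_cancel_right₀ hp]
    simp [hp]
  | coe z =>
    rw [OnePoint.continuousAt_coe]
    refine tendsto_ratio (R.num.continuous.tendsto z) (R.denom.continuous.tendsto z) ?_
    by_contra! hcon
    obtain ⟨u, v, huv⟩ := R.isCoprime_num_denom
    have := congrArg (Polynomial.eval z) huv
    simp [hcon.1, hcon.2] at this

/-! ## The Fatou and Julia sets -/

/-- A family `F` is normal on `U`: every sequence in `F` has a subsequence that converges uniformly
on each compact subset of `U`, in the chordal metric. -/
def IsNormalOn (F : Set (Sphere → Sphere)) (U : Set Sphere) : Prop :=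
  ∀ f : ℕ → Sphere → Sphere, (∀ n, f n ∈ F) →
    ∃ φ : ℕ → ℕ, StrictMono φ ∧ ∃ g : Sphere → Sphere,
      ∀ K ⊆ U, IsCompact K → ∀ ε > 0, ∃ N, ∀ j ≥ N, ∀ x ∈ K, chordalDist (f (φ j) x) (g x) < ε

/-- The family of iterates of a rational map. -/
def iterates (R : RatFunc ℂ) : Set (Sphere → Sphere) := range fun n : ℕ => (ratMap R)^[n]

/-- The Fatou set: the points with a neighbourhood on which the iterates form a normal family. -/
def fatou (R : RatFunc ℂ) : Set Sphere :=
  {z | ∃ U : Set Sphere, IsOpen U ∧ z ∈ U ∧ IsNormalOn (iterates R) U}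

/-- The Julia set. -/
def julia (R : RatFunc ℂ) : Set Sphere := (fatou R)ᶜ

theorem chordalDist_self (x : Sphere) : chordalDist x x = 0 := by
  induction x using OnePoint.rec with
  | infty => rfl
  | coe z =>
    change 2 * ‖z - z‖ / _ = 0
    simp

theorem mapsTo_julia (R : RatFunc ℂ) : MapsTo (ratMap R) (julia R) (julia R) := by
  rintro z hz ⟨U, hU, hzU, hN⟩
  refine hz ⟨ratMap R ⁻¹' U, hU.preimage (continuous_ratMap R), hzU, ?_⟩
  intro f hf
  choose s hs using hf
  by_cases h0 : ∃ᶠ n in atTop, s n = 0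
  · obtain ⟨φ, hφ, hφ0⟩ := extraction_of_frequently_atTop h0
    refine ⟨φ, hφ, id, fun K _ _ ε hε => ⟨0, fun j _ x _ => ?_⟩⟩
    rw [← hs]
    simpa [hφ0 j, chordalDist_self] using hε
  · rw [not_frequently, eventually_atTop] at h0
    obtain ⟨M, hM⟩ := h0
    obtain ⟨φ, hφ, g, hg⟩ := hN (fun n => (ratMap R)^[s (n + M) - 1]) (fun n => ⟨_, rfl⟩)
    refine ⟨fun j => φ j + M, fun i j hij => Nat.add_lt_add_right (hφ hij) M,
      g ∘ ratMap R, fun K hK hKc ε hε => ?_⟩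
    obtain ⟨N, hN'⟩ := hg (ratMap R '' K) (image_subset_iff.mpr hK)
      (hKc.image (continuous_ratMap R)) ε hε
    refine ⟨N, fun j hj x hx => ?_⟩
    have h1 := hN' j hj _ (mem_image_of_mem _ hx)
    rw [← Function.iterate_succ_apply] at h1
    have h2 : (s (φ j + M) - 1).succ = s (φ j + M) := by
      have := hM (φ j + M) (Nat.le_add_left _ _)
      omega
    rw [h2] at h1
    rw [← hs]
    exact h1

/-- The restriction of a rational map to its Julia set. -/
def juliaMap (R : RatFunc ℂ) : julia R → julia R := (mapsTo_julia R).restrict _ _ _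

/-! ## The centralizer of a rational map on its Julia set -/

/-- The compact-open topology on the homeomorphisms of a space, induced from that on the continuous
self-maps. -/
instance homeoTopology (X : Type*) [TopologicalSpace X] : TopologicalSpace (X ≃ₜ X) :=
  TopologicalSpace.induced (fun f => (⟨f, f.continuous⟩ : C(X, X))) inferInstance

/-- The group of homeomorphisms of the Julia set that commute with the rational map. -/
def juliaCentralizer (R : RatFunc ℂ) : Subgroup (julia R ≃ₜ julia R) where
  carrier := {f | ⇑f ∘ juliaMap R = juliaMap R ∘ ⇑f}
  one_mem' := rfl
  mul_mem' {f g} hf hg := by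
    funext x
    have h1 := congrFun hg x
    have h2 := congrFun hf (g x)
    simp only [Function.comp_apply, Homeomorph.mul_apply] at h1 h2 ⊢
    rw [h1, h2]
  inv_mem' {f} hf := by
    funext x
    have h1 := congrFun hf (f⁻¹ x)
    simp only [Function.comp_apply, Homeomorph.inv_apply, Homeomorph.apply_symm_apply] at h1 ⊢
    rw [← h1, Homeomorph.symm_apply_apply]

/-! ## Inverse limits of groups -/

/-- The inverse limit of groups `G i` along homomorphisms `f : G j →* G i`, `i ≤ j`, as a subgroup
of the product. As a subtype of the product it carries the inverse limit topology whenever the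
`G i` carry topologies. -/
def inverseLimit {ι : Type*} [Preorder ι] (G : ι → Type*) [∀ i, Group (G i)]
    (f : ∀ ⦃i j : ι⦄, i ≤ j → G j →* G i) : Subgroup (∀ i, G i) where
  carrier := {x | ∀ ⦃i j : ι⦄ (h : i ≤ j), f h (x j) = x i}
  one_mem' i j h := by simp
  mul_mem' hx hy i j h := by simp [hx h, hy h]
  inv_mem' hx i j h := by simp [hx h]

/-- For a sequence of sets `A 0, A 1, …`, the group of those permutations of `A n` that
preserve each `A k` with `k ≤ n`. -/
def towerPerm {X : Type*} (A : ℕ → Set X) (n : ℕ) : Subgroup (Equiv.Perm (A n)) where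
  carrier := {σ | ∀ k ≤ n, ∀ x : A n, ((σ x : A n) : X) ∈ A k ↔ (x : X) ∈ A k}
  one_mem' k _ x := Iff.rfl
  mul_mem' {σ τ} hσ hτ k hk x := by
    rw [Equiv.Perm.mul_apply]
    exact (hσ k hk (τ x)).trans (hτ k hk x)
  inv_mem' {σ} hσ k hk x := by
    simpa using (hσ k hk (σ⁻¹ x)).symm

/-- The permutation groups of a tower of sets carry the discrete topology. -/
instance towerPermTopology {X : Type*} (A : ℕ → Set X) (n : ℕ) :
    TopologicalSpace (towerPerm A n) := ⊥

instance towerPermDiscrete {X : Type*} (A : ℕ → Set X) (n : ℕ) :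
    DiscreteTopology (towerPerm A n) := ⟨rfl⟩

/-- Restriction of permutations from `A m` to `A n`, for `n ≤ m`, in an increasing sequence. -/
def towerRestrict {X : Type*} {A : ℕ → Set X} (hA : Monotone A) ⦃n m : ℕ⦄ (h : n ≤ m) :
    towerPerm A m →* towerPerm A n where
  toFun σ :=
    ⟨{ toFun := fun x => ⟨(σ.1 ⟨x.1, hA h x.2⟩ : A m), (σ.2 n h _).2 x.2⟩
       invFun := fun x => ⟨(σ⁻¹.1 ⟨x.1, hA h x.2⟩ : A m), (σ⁻¹.2 n h _).2 x.2⟩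
       left_inv := fun x => by simp
       right_inv := fun x => by simp },
      fun k hk x => σ.2 k (hk.trans h) ⟨x.1, hA h x.2⟩⟩
  map_one' := rfl
  map_mul' _ _ := rfl

/-! ## The tower of iterated preimages of the periodic points of lowest period -/

/-- The periods (not necessarily minimal) of the periodic points in the Julia set. -/
def juliaPeriods (R : RatFunc ℂ) : Set ℕ :=
  {n | 0 < n ∧ ∃ z ∈ julia R, Function.IsPeriodicPt (ratMap R) n z}

/-- The lowest period of a periodic point in the Julia set. -/
def lowestPeriod (R : RatFunc ℂ) : ℕ := sInf (juliaPeriods R)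

/-- The increasing sequence of sets: first all periodic points in the Julia set of lowest period,
then each set together with its preimage under the rational map. -/
def tower (R : RatFunc ℂ) : ℕ → Set Sphere
  | 0 => {z ∈ julia R | Function.IsPeriodicPt (ratMap R) (lowestPeriod R) z}
  | n + 1 => ratMap R ⁻¹' tower R n ∪ tower R n

theorem tower_mono (R : RatFunc ℂ) : Monotone (tower R) :=
  monotone_nat_of_le_succ fun _ => subset_union_right

/-- The inverse limit of the permutation groups of the tower, along restriction. -/
abbrev cantorGroup (R : RatFunc ℂ) : Subgroup (∀ n, towerPerm (tower R) n) :=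
  inverseLimit (fun n => towerPerm (tower R) n) (towerRestrict (tower_mono R))

end RationalDynamics

end

open RationalDynamics

/-!
The lowest period is one. The fixed points of a rational map of degree `d ≥ 2` satisfy
`∑ 1 / (1 - λ) = 1` if none of the multipliers `λ` is one; there are then `d + 1 ≥ 3` of them, and
`1 / (1 - λ)` has real part at least `1 / 2` as soon as `‖λ‖ ≤ 1`. So there is a fixed point `x`
with `‖λ‖ > 1` or `λ = 1` (`exists_repelling_or_parabolic`). A Taylor coefficient at `x` of the
iterates is unbounded, while equicontinuity of the iterates would bound it by Cauchy's estimate;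
hence `x` lies in the Julia set (`HasMultiplier.mem_julia`). As `λ ≠ 0`, the map is not totally ramified at
`x`, and this makes the backward orbit of `x` infinite (`exists_fixed_mem_julia`,
`infinite_of_backward_invariant`).

The union of the tower is backward invariant, so an open set disjoint from it has all its
forward images disjoint from it too, and three points of the union are omitted by all iterates
there. Montel's theorem puts such a set into the Fatou set (`mem_fatou_of_omits`), which is the
density statement. Montel's theorem comes from a bound on the spherical derivative of a function
`f` omitting `0` and `1` (`norm_deriv_le_of_omits`), for which no modular function is needed:
Ahlfors' method applies to a metric of negative curvature written with fifth roots of `f` and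
`f - 1`. In place of Laplacians, `deriv_sq_add_deriv_sq_le` splits off the modulus of a holomorphic
function at an interior maximum and applies the maximum principle to it.

The Fatou set is the interior of the set of points of equicontinuity of the iterates, by the
theorem of Arzelà and Ascoli (`mem_fatou_iff`). This form makes its invariance under topological
conjugacy evident, and, the map being open, its complete invariance as well; the tower therefore
stays in the Julia set. What remains is formal: a centralizing homeomorphism of the Julia set
permutes each set of the tower, is determined by these permutations because the tower is
dense, and the resulting map into the profinite group is continuous because each set of the tower is
finite, hence discrete.

Holomorphy of maps into the sphere is expressed in homogeneous coordinates (`HoloAt`), with Möbius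
transformations given by Mathlib's action of `GL (Fin 2) ℂ` on `OnePoint ℂ`.
-/

namespace RationalDynamics

noncomputable section

/-! ### The chordal metric -/

/-- Stereographic projection, with the point at infinity sent to the north pole. -/
def stereo : Sphere → WithLp 2 (ℂ × ℝ)
  | some z => WithLp.toLp 2 ((2 / (1 + ‖z‖ ^ 2) : ℝ) • z, (‖z‖ ^ 2 - 1) / (1 + ‖z‖ ^ 2))
  | none => WithLp.toLp 2 (0, 1)

theorem dist_stereo (x y : Sphere) : dist (stereo x) (stereo y) = chordalDist x y := by
  have key : ∀ z : ℂ, √(1 + ‖z‖ ^ 2) ^ 2 = 1 + ‖z‖ ^ 2 := fun z => Real.sq_sqrt (by positivity)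
  have pos : ∀ z : ℂ, 0 < 1 + ‖z‖ ^ 2 := fun z => by positivity
  have inf : ∀ z : ℂ, dist (stereo (z : Sphere)) (stereo OnePoint.infty) = 2 / √(1 + ‖z‖ ^ 2) := by
    intro z
    rw [WithLp.prod_dist_eq_of_L2, Real.sqrt_eq_iff_mul_self_eq (by positivity) (by positivity)]
    change dist ((2 / (1 + ‖z‖ ^ 2) : ℝ) • z) 0 ^ 2
      + dist ((‖z‖ ^ 2 - 1) / (1 + ‖z‖ ^ 2)) 1 ^ 2 = _
    rw [dist_zero_right, norm_smul, Real.dist_eq, sq_abs, Real.norm_of_nonneg (by positivity)]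
    have := pos z
    rw [← sq, div_pow, key]
    field_simp
    ring
  induction x using OnePoint.rec with
  | infty =>
    induction y using OnePoint.rec with
    | infty => rw [dist_self]; rfl
    | coe w => rw [dist_comm, inf]; rfl
  | coe z =>
    induction y using OnePoint.rec with
    | infty => rw [inf]; rfl
    | coe w =>
      change _ = 2 * ‖z - w‖ / (√(1 + ‖z‖ ^ 2) * √(1 + ‖w‖ ^ 2))
      rw [WithLp.prod_dist_eq_of_L2, Real.sqrt_eq_iff_mul_self_eq (by positivity) (by positivity)]
      change dist ((2 / (1 + ‖z‖ ^ 2) : ℝ) • z) ((2 / (1 + ‖w‖ ^ 2) : ℝ) • w) ^ 2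
        + dist ((‖z‖ ^ 2 - 1) / (1 + ‖z‖ ^ 2)) ((‖w‖ ^ 2 - 1) / (1 + ‖w‖ ^ 2)) ^ 2 = _
      rw [dist_eq_norm, Real.dist_eq, sq_abs, ← sq, div_pow, mul_pow, mul_pow, key, key]
      have hz := pos z
      have hw := pos w
      rw [Complex.sq_norm] at hz
      rw [Complex.sq_norm] at hw
      rw [Complex.sq_norm, Complex.sq_norm, Complex.sq_norm, Complex.sq_norm]
      rw [Complex.normSq_apply] at *
      rw [Complex.normSq_apply] at *
      rw [Complex.normSq_apply, Complex.normSq_apply (z - w), ]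
      simp only [Complex.sub_re, Complex.sub_im, Complex.real_smul, Complex.mul_re, Complex.mul_im,
        Complex.ofReal_re, Complex.ofReal_im, zero_mul, sub_zero, add_zero]
      field_simp
      ring

theorem continuous_stereo : Continuous stereo := by
  rw [continuous_iff_continuousAt]
  intro x
  induction x using OnePoint.rec with
  | infty =>
    rw [OnePoint.continuousAt_infty', coclosedCompact_eq_cocompact,
      ← Metric.cobounded_eq_cocompact, tendsto_iff_dist_tendsto_zero]
    refine squeeze_zero' (g := fun w : ℂ => 2 * ‖w‖⁻¹) (.of_forall fun w => dist_nonneg) ?_ ?_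
    · filter_upwards [Bornology.eventually_ne_cobounded (0 : ℂ)] with w hw
      rw [Function.comp_apply, dist_stereo]
      change 2 / √(1 + ‖w‖ ^ 2) ≤ _
      rw [div_eq_mul_inv]
      have h : ‖w‖ ≤ √(1 + ‖w‖ ^ 2) := Real.le_sqrt_of_sq_le (by linarith)
      have := norm_pos_iff.mpr hw
      gcongr
    · simpa using (tendsto_norm_cobounded_atTop.inv_tendsto_atTop).const_mul (2 : ℝ)
  | coe z =>
    rw [OnePoint.continuousAt_coe, ContinuousAt, tendsto_iff_dist_tendsto_zero]
    refine squeeze_zero (g := fun w => 2 * ‖w - z‖) (fun w => dist_nonneg) (fun w => ?_) ?_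
    · rw [Function.comp_apply, Function.comp_apply, dist_stereo]
      change 2 * ‖w - z‖ / (√(1 + ‖w‖ ^ 2) * √(1 + ‖z‖ ^ 2)) ≤ _
      refine div_le_self (by positivity) ?_
      have h : ∀ a : ℂ, 1 ≤ √(1 + ‖a‖ ^ 2) := fun a => by
        rw [Real.one_le_sqrt]; nlinarith [sq_nonneg ‖a‖]
      nlinarith [h w, h z]
    · have : Continuous fun w : ℂ => 2 * ‖w - z‖ := by fun_prop
      simpa using this.tendsto z

theorem injective_stereo : Function.Injective stereo := by
  intro x y h
  have h : chordalDist x y = 0 := by rw [← dist_stereo, h, dist_self]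
  have pos : ∀ z : ℂ, 0 < √(1 + ‖z‖ ^ 2) := fun z => by positivity
  induction x using OnePoint.rec with
  | infty =>
    induction y using OnePoint.rec with
    | infty => rfl
    | coe w => exact absurd h (div_pos two_pos (pos w)).ne'
  | coe z =>
    induction y using OnePoint.rec with
    | infty => exact absurd h (div_pos two_pos (pos z)).ne'
    | coe w =>
      change 2 * ‖z - w‖ / (√(1 + ‖z‖ ^ 2) * √(1 + ‖w‖ ^ 2)) = 0 at h
      rw [div_eq_zero_iff, or_iff_left (mul_pos (pos z) (pos w)).ne'] at h
      have h0 : ‖z - w‖ = 0 := by linarith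
      rw [sub_eq_zero.mp (norm_eq_zero.mp h0)]

/-- The chordal metric, compatible with the topology of the sphere. -/
instance chordalMetric : MetricSpace Sphere :=
  Topology.IsEmbedding.comapMetricSpace stereo
    (continuous_stereo.isClosedEmbedding injective_stereo).isEmbedding

theorem dist_eq_chordalDist (x y : Sphere) : dist x y = chordalDist x y := dist_stereo x y

/-! ### Homogeneous coordinates and Möbius transformations -/

theorem ratio_one (z : ℂ) : ratio z 1 = z := by simp [ratio]

theorem ratio_zero (a : ℂ) : ratio a 0 = OnePoint.infty := by simp [ratio]

theorem ratio_of_ne {a b : ℂ} (h : b ≠ 0) : ratio a b = ((a / b : ℂ) : Sphere) := by simp [ratio, h]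

theorem exists_ratio (x : Sphere) : ∃ a b : ℂ, (a ≠ 0 ∨ b ≠ 0) ∧ x = ratio a b := by
  induction x using OnePoint.rec with
  | infty => exact ⟨1, 0, by simp, (ratio_zero 1).symm⟩
  | coe z => exact ⟨z, 1, by simp, (ratio_one z).symm⟩

theorem ratio_eq_ratio_iff {a b c d : ℂ} (h : a ≠ 0 ∨ b ≠ 0) (h' : c ≠ 0 ∨ d ≠ 0) :
    ratio a b = ratio c d ↔ a * d = c * b := by
  by_cases hb : b = 0 <;> by_cases hd : d = 0
  · simp [ratio, hb, hd]
  · have ha : a ≠ 0 := h.resolve_right (by simpa using hb)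
    simp [ratio, hb, hd, ha]
  · have hc : c ≠ 0 := h'.resolve_right (by simpa using hd)
    simp [ratio, hb, hd, hc]
  · simp [ratio, hb, hd, div_eq_div_iff]

open scoped Classical in
theorem smul_ratio (g : GL (Fin 2) ℂ) {a b : ℂ} (h : a ≠ 0 ∨ b ≠ 0) :
    g • ratio a b = ratio (g 0 0 * a + g 0 1 * b) (g 1 0 * a + g 1 1 * b) := by
  by_cases hb : b = 0
  · have ha : a ≠ 0 := h.resolve_right (by simpa using hb)
    subst hb
    rw [ratio_zero, OnePoint.smul_infty_eq_ite]
    simp [ratio, ha, mul_div_mul_right]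
  · have e : g 1 0 * a + g 1 1 * b = b * (g 1 0 * (a / b) + g 1 1) := by field_simp
    have e' : g 0 0 * a + g 0 1 * b = b * (g 0 0 * (a / b) + g 0 1) := by field_simp
    rw [ratio_of_ne hb, OnePoint.smul_some_eq_ite, ratio, e, e', mul_div_mul_left _ _ hb]
    simp [hb]

theorem gl_apply_ne (g : GL (Fin 2) ℂ) {a b : ℂ} (h : a ≠ 0 ∨ b ≠ 0) :
    g 0 0 * a + g 0 1 * b ≠ 0 ∨ g 1 0 * a + g 1 1 * b ≠ 0 := by
  by_contra! hc
  have hdet := g.det_ne_zero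
  rw [Matrix.det_fin_two] at hdet
  have ha : (g 0 0 * g 1 1 - g 0 1 * g 1 0) * a = 0 := by
    linear_combination g 1 1 * hc.1 - g 0 1 * hc.2
  have hb : (g 0 0 * g 1 1 - g 0 1 * g 1 0) * b = 0 := by
    linear_combination g 0 0 * hc.2 - g 1 0 * hc.1
  simp only [mul_eq_zero, hdet, false_or] at ha hb
  simp [ha, hb] at h

open scoped Classical in
theorem continuous_gl_smul (g : GL (Fin 2) ℂ) : Continuous fun x : Sphere => g • x := by
  rw [continuous_iff_continuousAt]
  intro x
  induction x using OnePoint.rec with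
  | infty =>
    rw [OnePoint.continuousAt_infty', coclosedCompact_eq_cocompact,
      ← Metric.cobounded_eq_cocompact, ← ratio_zero 1, smul_ratio g (by simp)]
    have h0 : Tendsto (fun z : ℂ => z⁻¹) (Bornology.cobounded ℂ) (𝓝 0) := tendsto_inv₀_cobounded
    refine (tendsto_ratio (tendsto_const_nhds.add (h0.const_mul _))
      (tendsto_const_nhds.add (h0.const_mul _)) (gl_apply_ne g (by simp))).congr' ?_
    filter_upwards [Bornology.eventually_ne_cobounded (0 : ℂ)] with z hz
    have : (z : Sphere) = ratio 1 z⁻¹ := by simp [ratio, hz]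
    rw [Function.comp_apply, this, smul_ratio g (by simp)]
  | coe z =>
    rw [OnePoint.continuousAt_coe]
    have : ∀ w : ℂ, g • (w : Sphere) = ratio (g 0 0 * w + g 0 1 * 1) (g 1 0 * w + g 1 1 * 1) :=
      fun w => by rw [← ratio_one w, smul_ratio g (by simp)]
    simp only [Function.comp_def, ContinuousAt, this]
    have hc : ∀ a b : ℂ, Tendsto (fun w => a * w + b * 1) (𝓝 z) (𝓝 (a * z + b * 1)) :=
      fun a b => (by fun_prop : Continuous fun w : ℂ => a * w + b * 1).tendsto z
    exact tendsto_ratio (hc _ _) (hc _ _) (gl_apply_ne g (by simp))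

open scoped Classical in
/-- The Möbius transformation of an invertible matrix, as a homeomorphism of the sphere. -/
def mobius (g : GL (Fin 2) ℂ) : Sphere ≃ₜ Sphere where
  toEquiv := MulAction.toPerm g
  continuous_toFun := continuous_gl_smul g
  continuous_invFun := continuous_gl_smul g⁻¹

theorem mobius_ratio (g : GL (Fin 2) ℂ) {a b : ℂ} (h : a ≠ 0 ∨ b ≠ 0) :
    mobius g (ratio a b) = ratio (g 0 0 * a + g 0 1 * b) (g 1 0 * a + g 1 1 * b) :=
  smul_ratio g h

theorem mobius_symm (g : GL (Fin 2) ℂ) : (mobius g).symm = mobius g⁻¹ := rfl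

theorem exists_mobius_swap :
    ∃ g, ∀ a b : ℂ, (a ≠ 0 ∨ b ≠ 0) → mobius g (ratio a b) = ratio b a := by
  refine ⟨Matrix.GeneralLinearGroup.mkOfDetNeZero !![0, 1; 1, 0] (by simp), fun a b h => ?_⟩
  rw [mobius_ratio _ h]
  simp [Matrix.GeneralLinearGroup.mkOfDetNeZero]

theorem exists_mobius_translate (z : ℂ) :
    ∃ g, ∀ w : ℂ, mobius g (w : Sphere) = ((w + z : ℂ) : Sphere) := by
  refine ⟨Matrix.GeneralLinearGroup.mkOfDetNeZero !![1, z; 0, 1] (by simp), fun w => ?_⟩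
  rw [← ratio_one w, mobius_ratio _ (by simp)]
  simp [Matrix.GeneralLinearGroup.mkOfDetNeZero, ratio]

theorem exists_mobius_zero (x : Sphere) : ∃ g, mobius g ((0 : ℂ) : Sphere) = x := by
  induction x using OnePoint.rec with
  | infty =>
    obtain ⟨g, hg⟩ := exists_mobius_swap
    exact ⟨g, by rw [← ratio_one, hg _ _ (by simp), ratio_zero]⟩
  | coe z =>
    obtain ⟨g, hg⟩ := exists_mobius_translate z
    exact ⟨g, by rw [hg, zero_add]⟩

/-- Three distinct points can be moved to `0`, `1`, `∞`. -/
theorem exists_mobius_three {p q r : Sphere} (hpq : p ≠ q) (hpr : p ≠ r) (hqr : q ≠ r) :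
    ∃ g, mobius g p = ratio 0 1 ∧ mobius g q = ratio 1 1 ∧ mobius g r = ratio 1 0 := by
  obtain ⟨a, b, h1, rfl⟩ := exists_ratio p
  obtain ⟨c, d, h2, rfl⟩ := exists_ratio q
  obtain ⟨e, f, h3, rfl⟩ := exists_ratio r
  rw [Ne, ratio_eq_ratio_iff h1 h2, ← sub_eq_zero] at hpq
  rw [Ne, ratio_eq_ratio_iff h1 h3, ← sub_eq_zero] at hpr
  rw [Ne, ratio_eq_ratio_iff h2 h3, ← sub_eq_zero] at hqr
  -- the cross ratio `x ↦ [x, p] [q, r] : [x, r] [q, p]`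
  have hdet : !![b * (c * f - e * d), -a * (c * f - e * d);
      -f * (a * d - c * b), e * (a * d - c * b)].det ≠ 0 := by
    rw [Matrix.det_fin_two_of]
    have : b * (c * f - e * d) * (e * (a * d - c * b)) -
      -a * (c * f - e * d) * (-f * (a * d - c * b)) =
      -((a * d - c * b) * (a * f - e * b) * (c * f - e * d)) := by ring
    rw [this]
    exact neg_ne_zero.mpr (mul_ne_zero (mul_ne_zero hpq hpr) hqr)
  have hm := fun (x y : ℂ) (h : x ≠ 0 ∨ y ≠ 0) =>
    mobius_ratio (Matrix.GeneralLinearGroup.mkOfDetNeZero _ hdet) h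
  have hn := fun (x y : ℂ) (h : x ≠ 0 ∨ y ≠ 0) =>
    gl_apply_ne (Matrix.GeneralLinearGroup.mkOfDetNeZero _ hdet) h
  refine ⟨_, (hm _ _ h1).trans ?_, (hm _ _ h2).trans ?_, (hm _ _ h3).trans ?_⟩
  · rw [ratio_eq_ratio_iff (hn _ _ h1) (by simp)]
    simp [Matrix.GeneralLinearGroup.mkOfDetNeZero]
    ring
  · rw [ratio_eq_ratio_iff (hn _ _ h2) (by simp)]
    simp [Matrix.GeneralLinearGroup.mkOfDetNeZero]
    ring
  · rw [ratio_eq_ratio_iff (hn _ _ h3) (by simp)]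
    simp [Matrix.GeneralLinearGroup.mkOfDetNeZero]
    ring

/-! ### Holomorphic maps into the sphere -/

/-- A map from the plane to the sphere is holomorphic at a point if near it the map has
holomorphic homogeneous coordinates without a common zero. -/
def HoloAt (f : ℂ → Sphere) (z : ℂ) : Prop :=
  ∃ a b : ℂ → ℂ, AnalyticAt ℂ a z ∧ AnalyticAt ℂ b z ∧ (a z ≠ 0 ∨ b z ≠ 0) ∧
    ∀ᶠ w in 𝓝 z, f w = ratio (a w) (b w)

theorem eventually_ne_or_ne {a b : ℂ → ℂ} {z : ℂ} (ha : AnalyticAt ℂ a z) (hb : AnalyticAt ℂ b z)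
    (h : a z ≠ 0 ∨ b z ≠ 0) : ∀ᶠ w in 𝓝 z, a w ≠ 0 ∨ b w ≠ 0 := by
  rcases h with h | h
  · filter_upwards [ha.continuousAt.eventually_ne h] with w hw using Or.inl hw
  · filter_upwards [hb.continuousAt.eventually_ne h] with w hw using Or.inr hw

theorem HoloAt.mobius {f : ℂ → Sphere} {z : ℂ} (hf : HoloAt f z) (g : GL (Fin 2) ℂ) :
    HoloAt (fun w => mobius g (f w)) z := by
  obtain ⟨a, b, ha, hb, h, hev⟩ := hf
  refine ⟨fun w => g 0 0 * a w + g 0 1 * b w, fun w => g 1 0 * a w + g 1 1 * b w,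
    by fun_prop, by fun_prop, gl_apply_ne g h, ?_⟩
  filter_upwards [hev, eventually_ne_or_ne ha hb h] with w hw hne
  rw [hw, mobius_ratio g hne]

theorem holoAt_coe (z : ℂ) : HoloAt (fun w => (w : Sphere)) z :=
  ⟨id, fun _ => 1, analyticAt_id, analyticAt_const, by simp, by simp [ratio_one]⟩

/-- The finite part of a point of the sphere, with value `0` at infinity. -/
def toPlane : Sphere → ℂ
  | some z => z
  | none => 0

@[simp] theorem toPlane_coe (z : ℂ) : toPlane (z : Sphere) = z := rfl

theorem coe_toPlane {x : Sphere} (h : x ≠ ratio 1 0) : (toPlane x : Sphere) = x := by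
  induction x using OnePoint.rec with
  | infty => exact absurd (ratio_zero 1).symm h
  | coe z => rfl

theorem HoloAt.analyticAt {f : ℂ → Sphere} {z : ℂ} (hf : HoloAt f z) (h : f z ≠ ratio 1 0) :
    AnalyticAt ℂ (fun w => toPlane (f w)) z := by
  obtain ⟨a, b, ha, hb, hab, hev⟩ := hf
  have hbz : b z ≠ 0 := fun hb0 => h (by rw [hev.self_of_nhds, hb0, ratio_zero, ratio_zero])
  refine (ha.div hb hbz).congr ?_
  filter_upwards [hev, hb.continuousAt.eventually_ne hbz] with w hw hbw
  rw [hw, ratio_of_ne hbw]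
  rfl

end

noncomputable section

/-! ### A bound for functions omitting two values -/

open Metric

/-- A function `|E|² (1 - |μ|²)² (1 + |m|²) (1 + |n|²)`, with all of `E, μ, m, n` holomorphic and
`μ, m, n` vanishing at `z₀`, has a local maximum at `z₀` only if the convex factors do not win
against the concave one. By the maximum principle `|E|` does not have a strict maximum,
so that the other factors take values at most one at points close to `z₀`. -/
theorem deriv_sq_add_deriv_sq_le {E μ m n : ℂ → ℂ} {z₀ : ℂ} (hE : AnalyticAt ℂ E z₀)
    (hE0 : E z₀ ≠ 0) {μ' m' n' : ℂ} (hμ : HasDerivAt μ μ' z₀) (hm : HasDerivAt m m' z₀)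
    (hn : HasDerivAt n n' z₀) (hμ0 : μ z₀ = 0) (hm0 : m z₀ = 0) (hn0 : n z₀ = 0)
    (hmax : ∀ᶠ z in 𝓝 z₀, ‖E z‖ ^ 2 * (1 - ‖μ z‖ ^ 2) ^ 2 * (1 + ‖m z‖ ^ 2) * (1 + ‖n z‖ ^ 2)
      ≤ ‖E z₀‖ ^ 2) :
    ‖m'‖ ^ 2 + ‖n'‖ ^ 2 ≤ 2 * ‖μ'‖ ^ 2 := by
  have hfreq : ∃ᶠ z in 𝓝[≠] z₀, ‖E z₀‖ ≤ ‖E z‖ := by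
    intro hlt
    have hlt' : ∀ᶠ z in 𝓝[≠] z₀, ‖E z‖ < ‖E z₀‖ := by simpa using hlt
    have hloc : IsLocalMax (norm ∘ E) z₀ := by
      rw [eventually_nhdsWithin_iff] at hlt'
      filter_upwards [hlt'] with z hz
      by_cases h : z = z₀
      · rw [h]
      · exact (hz h).le
    have hd : ∀ᶠ z in 𝓝 z₀, DifferentiableAt ℂ E z :=
      hE.eventually_analyticAt.mono fun z hz => hz.differentiableAt
    have heq := (Complex.norm_eventually_eq_of_isLocalMax hd hloc).filter_mono
      (nhdsWithin_le_nhds (s := {z₀}ᶜ))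
    obtain ⟨z, hz1, hz2⟩ := (hlt'.and heq).exists
    exact hz1.ne hz2
  have lim : ∀ {p : ℂ → ℂ} {p' : ℂ}, HasDerivAt p p' z₀ → p z₀ = 0 →
      Tendsto (fun z => ‖p z‖ ^ 2 / ‖z - z₀‖ ^ 2) (𝓝[≠] z₀) (𝓝 (‖p'‖ ^ 2)) := by
    intro p p' hp hp0
    refine ((hasDerivAt_iff_tendsto_slope.mp hp).norm.pow 2).congr fun z => ?_
    rw [slope_def_field, hp0, sub_zero, norm_div, div_pow]
  have lim0 : ∀ {p : ℂ → ℂ} {p' : ℂ}, HasDerivAt p p' z₀ → p z₀ = 0 →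
      Tendsto (fun z => ‖p z‖ ^ 2) (𝓝[≠] z₀) (𝓝 0) := by
    intro p p' hp hp0
    have := (hp.continuousAt.tendsto.norm.pow 2).mono_left (nhdsWithin_le_nhds (s := {z₀}ᶜ))
    simpa [hp0] using this
  have hR : Tendsto (fun z => 2 * (‖μ z‖ ^ 2 / ‖z - z₀‖ ^ 2) * (1 + (‖m z‖ ^ 2 + ‖n z‖ ^ 2)))
      (𝓝[≠] z₀) (𝓝 (2 * ‖μ'‖ ^ 2 * (1 + (0 + 0)))) :=
    ((lim hμ hμ0).const_mul 2).mul (((lim0 hm hm0).add (lim0 hn hn0)).const_add 1)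
  rw [add_zero, add_zero, mul_one] at hR
  refine le_of_tendsto_of_tendsto_of_frequently ((lim hm hm0).add (lim hn hn0)) hR ?_
  refine (hfreq.and_eventually ((hmax.filter_mono nhdsWithin_le_nhds).and
    (self_mem_nhdsWithin))).mono ?_
  rintro z ⟨hz1, hz2, hz3⟩
  have hd : 0 < ‖z - z₀‖ ^ 2 := by
    have : 0 < ‖z - z₀‖ := norm_pos_iff.mpr (sub_ne_zero.mpr hz3)
    positivity
  have hEp : 0 < ‖E z₀‖ ^ 2 := by
    have := norm_pos_iff.mpr hE0
    positivity
  have h1 : (1 - ‖μ z‖ ^ 2) ^ 2 * (1 + ‖m z‖ ^ 2) * (1 + ‖n z‖ ^ 2) ≤ 1 := by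
    refine le_of_mul_le_mul_left ?_ hEp
    calc ‖E z₀‖ ^ 2 * ((1 - ‖μ z‖ ^ 2) ^ 2 * (1 + ‖m z‖ ^ 2) * (1 + ‖n z‖ ^ 2))
        ≤ ‖E z‖ ^ 2 * ((1 - ‖μ z‖ ^ 2) ^ 2 * (1 + ‖m z‖ ^ 2) * (1 + ‖n z‖ ^ 2)) := by gcongr
      _ = ‖E z‖ ^ 2 * (1 - ‖μ z‖ ^ 2) ^ 2 * (1 + ‖m z‖ ^ 2) * (1 + ‖n z‖ ^ 2) := by ring
      _ ≤ ‖E z₀‖ ^ 2 * 1 := by rwa [mul_one]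
  rw [← add_div, ← mul_div_assoc, div_mul_eq_mul_div, div_le_div_iff_of_pos_right hd]
  set s := ‖m z‖ ^ 2
  set t := ‖n z‖ ^ 2
  set u := ‖μ z‖ ^ 2
  have hs : 0 ≤ s := by positivity
  have ht : 0 ≤ t := by positivity
  have hu : 0 ≤ u := by positivity
  have h2 : (1 - 2 * u) * (1 + s + t) ≤ (1 - u) ^ 2 * (1 + s) * (1 + t) := by
    have : (1 - u) ^ 2 * (1 + s) * (1 + t) - (1 - 2 * u) * (1 + s + t)
      = u ^ 2 * (1 + s + t) + (1 - u) ^ 2 * (s * t) := by ring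
    have : 0 ≤ u ^ 2 * (1 + s + t) + (1 - u) ^ 2 * (s * t) := by positivity
    linarith
  nlinarith

theorem normSq_identity_add (g c : ℂ) :
    (1 + ‖g‖ ^ 2) * (1 + ‖c‖ ^ 2) = ‖1 + starRingEnd ℂ c * g‖ ^ 2 + ‖g - c‖ ^ 2 := by
  simp only [Complex.sq_norm, Complex.normSq_apply, Complex.add_re, Complex.add_im, Complex.sub_re,
    Complex.sub_im, Complex.mul_re, Complex.mul_im, Complex.conj_re, Complex.conj_im,
    Complex.one_re, Complex.one_im]
  ring

theorem normSq_identity_sub (r : ℝ) (z c : ℂ) :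
    (r ^ 2 - ‖z‖ ^ 2) * (r ^ 2 - ‖c‖ ^ 2)
      = ‖(r : ℂ) ^ 2 - starRingEnd ℂ c * z‖ ^ 2 - ‖(r : ℂ) * (z - c)‖ ^ 2 := by
  rw [← Complex.ofReal_pow]
  simp only [Complex.sq_norm, Complex.normSq_apply, Complex.sub_re,
    Complex.sub_im, Complex.mul_re, Complex.mul_im, Complex.conj_re, Complex.conj_im,
    Complex.ofReal_re, Complex.ofReal_im]
  ring

theorem one_add_conj_mul_self (c : ℂ) : 1 + starRingEnd ℂ c * c = ((1 + ‖c‖ ^ 2 : ℝ) : ℂ) := by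
  rw [Complex.conj_mul']; push_cast; rfl

/-- The curvature inequality: if `a⁵` and `b⁵` are the distances of a point to `0` and `1`, the
metric `√(1 + a²) √(1 + b²) / (a⁴ b⁴)` has curvature bounded above by a negative constant. -/
theorem curvature_inequality {a b : ℝ} (ha : 0 ≤ a) (hb : 0 ≤ b) (h : 1 ≤ a ^ 5 + b ^ 5) :
    (1 + a ^ 2) * (1 + b ^ 2) ≤ 81 * (b ^ 8 / (1 + a ^ 2) ^ 2 + a ^ 8 / (1 + b ^ 2) ^ 2) := by
  wlog hab : a ≤ b generalizing a b
  · have := this hb ha (by linarith) (le_of_not_ge hab)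
    linarith
  have hb2 : 1 / 2 ≤ b ^ 2 := by
    by_contra! hlt
    have hb1 : b < 1 := by nlinarith
    have h4 : b ^ 4 ≤ 1 / 4 := by nlinarith
    have h5 : b ^ 5 ≤ 1 / 4 := by nlinarith [pow_nonneg hb 4]
    have : a ^ 5 ≤ b ^ 5 := by gcongr
    linarith
  have h2 : a ^ 2 ≤ b ^ 2 := by gcongr
  have h8 : (1 + b ^ 2) ^ 4 ≤ 81 * b ^ 8 := by
    calc (1 + b ^ 2) ^ 4 ≤ (3 * b ^ 2) ^ 4 := by gcongr; linarith
      _ = 81 * b ^ 8 := by ring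
  calc (1 + a ^ 2) * (1 + b ^ 2) ≤ (1 + b ^ 2) * (1 + b ^ 2) := by gcongr
    _ = (1 + b ^ 2) ^ 4 / (1 + b ^ 2) ^ 2 := by field_simp
    _ ≤ 81 * b ^ 8 / (1 + b ^ 2) ^ 2 := by gcongr
    _ = 81 * (b ^ 8 / (1 + b ^ 2) ^ 2) := by ring
    _ ≤ 81 * (b ^ 8 / (1 + a ^ 2) ^ 2) := by gcongr
    _ ≤ _ := by
      have : 0 ≤ a ^ 8 / (1 + b ^ 2) ^ 2 := by positivity
      linarith

theorem hasDerivAt_cayley {g : ℂ → ℂ} {g' z₀ : ℂ} (hg : HasDerivAt g g' z₀) :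
    HasDerivAt (fun z => (g z - g z₀) / (1 + starRingEnd ℂ (g z₀) * g z))
      (g' / (1 + ‖g z₀‖ ^ 2 : ℝ)) z₀ := by
  have h0 : ((1 + ‖g z₀‖ ^ 2 : ℝ) : ℂ) ≠ 0 := by
    rw [Complex.ofReal_ne_zero]; positivity
  have h1 : 1 + starRingEnd ℂ (g z₀) * g z₀ ≠ 0 := by rwa [one_add_conj_mul_self]
  refine ((hg.sub_const (g z₀)).div
    ((hg.const_mul (starRingEnd ℂ (g z₀))).const_add 1) h1).congr_deriv ?_
  rw [sub_self, zero_mul, sub_zero, one_add_conj_mul_self]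
  field_simp

/-- The Ahlfors–Schwarz lemma for the pull-back of the metric of `curvature_inequality`
under `a⁵`, where `a` and `b` are fifth roots of a function and of its difference from `1`. -/
theorem ahlfors_schwarz {a b H : ℂ → ℂ} {R r : ℝ} (hrR : r < R)
    (ha : DifferentiableOn ℂ a (ball 0 R)) (hb : DifferentiableOn ℂ b (ball 0 R))
    (hH : DifferentiableOn ℂ H (ball 0 R)) (hab : ∀ z ∈ ball 0 R, a z ^ 5 = b z ^ 5 + 1)
    (hHa : ∀ z ∈ ball 0 R, deriv a z = H z * b z ^ 4)
    (hHb : ∀ z ∈ ball 0 R, deriv b z = H z * a z ^ 4) {z : ℂ} (hz : z ∈ closedBall 0 r) :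
    (r ^ 2 - ‖z‖ ^ 2) ^ 2 * ‖H z‖ ^ 2 * (1 + ‖a z‖ ^ 2) * (1 + ‖b z‖ ^ 2) ≤ 162 * r ^ 2 := by
  -- up to a constant, the square of the ratio of the pulled back metric to the hyperbolic metric
  -- of the disc of radius `r`, which vanishes on the boundary circle
  set v : ℂ → ℝ := fun z =>
    (r ^ 2 - ‖z‖ ^ 2) ^ 2 * ‖H z‖ ^ 2 * (1 + ‖a z‖ ^ 2) * (1 + ‖b z‖ ^ 2) with hv
  have hsub : closedBall (0 : ℂ) r ⊆ ball 0 R := closedBall_subset_ball hrR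
  have hcont : ContinuousOn v (closedBall 0 r) := by
    have h1 := ha.continuousOn.mono hsub
    have h2 := hb.continuousOn.mono hsub
    have h3 := hH.continuousOn.mono hsub
    rw [hv]
    fun_prop
  obtain ⟨c, hc, hmax⟩ := (isCompact_closedBall (0 : ℂ) r).exists_isMaxOn ⟨z, hz⟩ hcont
  refine (hmax hz).trans ?_
  change v c ≤ _
  have hv0 : v c = 0 → v c ≤ 162 * r ^ 2 := fun h => h.trans_le (by positivity)
  have hcr : ‖c‖ ≤ r := by simpa using hc
  rcases hcr.eq_or_lt with hcr | hcr
  · exact hv0 (by simp [hv, hcr])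
  rcases eq_or_ne (H c) 0 with hHc | hHc
  · exact hv0 (by simp [hv, hHc])
  have hcR := hsub hc
  have hnhds : ball (0 : ℂ) R ∈ 𝓝 c := isOpen_ball.mem_nhds hcR
  have hd : 0 < r ^ 2 - ‖c‖ ^ 2 := by nlinarith [norm_nonneg c]
  have hda := (ha.differentiableAt hnhds).hasDerivAt
  have hdb := (hb.differentiableAt hnhds).hasDerivAt
  have hAa := ha.analyticAt hnhds
  have hAb := hb.analyticAt hnhds
  have hAH := hH.analyticAt hnhds
  have hden : (r : ℂ) ^ 2 - starRingEnd ℂ c * c = ((r ^ 2 - ‖c‖ ^ 2 : ℝ) : ℂ) := by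
    rw [Complex.conj_mul']; push_cast; rfl
  have hden0 : ((r ^ 2 - ‖c‖ ^ 2 : ℝ) : ℂ) ≠ 0 := Complex.ofReal_ne_zero.mpr hd.ne'
  have hμ : HasDerivAt (fun z => (r : ℂ) * (z - c) / ((r : ℂ) ^ 2 - starRingEnd ℂ c * z))
      ((r : ℂ) / ((r ^ 2 - ‖c‖ ^ 2 : ℝ) : ℂ)) c := by
    refine ((((hasDerivAt_id c).sub_const c).const_mul (r : ℂ)).div
      (((hasDerivAt_id c).const_mul (starRingEnd ℂ c)).const_sub ((r : ℂ) ^ 2))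
      (by rwa [id, hden])).congr_deriv ?_
    simp only [id, sub_self, mul_zero, zero_mul, sub_zero, mul_one]
    rw [hden]
    field_simp
  set E : ℂ → ℂ := fun z => H z * ((r : ℂ) ^ 2 - starRingEnd ℂ c * z) ^ 2 *
    (1 + starRingEnd ℂ (a c) * a z) * (1 + starRingEnd ℂ (b c) * b z) with hEdef
  have hpos : ∀ w : ℂ, (0 : ℝ) < 1 + ‖w‖ ^ 2 := fun w => by positivity
  have hEc : ‖E c‖ ^ 2 = v c * ((r ^ 2 - ‖c‖ ^ 2) ^ 2 * (1 + ‖a c‖ ^ 2) * (1 + ‖b c‖ ^ 2)) := by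
    rw [hEdef]
    simp only
    rw [one_add_conj_mul_self, one_add_conj_mul_self, hden]
    simp only [norm_mul, norm_pow, Complex.norm_real, Real.norm_of_nonneg hd.le,
      Real.norm_of_nonneg (hpos _).le, hv]
    ring
  -- nonvanishing of the denominators near `c`, which the next identities divide by
  have hev : ∀ᶠ z in 𝓝 c, 1 + starRingEnd ℂ (a c) * a z ≠ 0 ∧ 1 + starRingEnd ℂ (b c) * b z ≠ 0 ∧
      (r : ℂ) ^ 2 - starRingEnd ℂ c * z ≠ 0 := by
    refine .and ?_ (.and ?_ ?_)
    · refine ContinuousAt.eventually_ne (by fun_prop) ?_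
      rw [one_add_conj_mul_self]
      exact Complex.ofReal_ne_zero.mpr (hpos _).ne'
    · refine ContinuousAt.eventually_ne (by fun_prop) ?_
      rw [one_add_conj_mul_self]
      exact Complex.ofReal_ne_zero.mpr (hpos _).ne'
    · refine ContinuousAt.eventually_ne (by fun_prop) ?_
      rwa [hden]
  have hkey := deriv_sq_add_deriv_sq_le (E := E) (z₀ := c) (by fun_prop) ?_ hμ
    (hasDerivAt_cayley hda) (hasDerivAt_cayley hdb) (by simp) (by simp) (by simp) ?_
  · rw [hHa c hcR, hHb c hcR] at hkey
    simp only [norm_div, norm_mul, norm_pow, Complex.norm_real, Real.norm_of_nonneg hd.le,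
      Real.norm_of_nonneg (hpos _).le, Real.norm_eq_abs] at hkey
    simp only [div_pow, mul_pow, sq_abs] at hkey
    have h5 : 1 ≤ ‖a c‖ ^ 5 + ‖b c‖ ^ 5 := by
      have : a c ^ 5 - b c ^ 5 = 1 := by rw [hab c hcR]; ring
      calc (1 : ℝ) = ‖a c ^ 5 - b c ^ 5‖ := by rw [this, norm_one]
        _ ≤ ‖a c ^ 5‖ + ‖b c ^ 5‖ := norm_sub_le _ _
        _ = _ := by rw [norm_pow, norm_pow]
    have hcurv := curvature_inequality (norm_nonneg (a c)) (norm_nonneg (b c)) h5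
    calc v c = (r ^ 2 - ‖c‖ ^ 2) ^ 2 * ‖H c‖ ^ 2 * ((1 + ‖a c‖ ^ 2) * (1 + ‖b c‖ ^ 2)) := by
          simp only [hv]; ring
      _ ≤ (r ^ 2 - ‖c‖ ^ 2) ^ 2 * ‖H c‖ ^ 2 * (81 * (‖b c‖ ^ 8 / (1 + ‖a c‖ ^ 2) ^ 2
          + ‖a c‖ ^ 8 / (1 + ‖b c‖ ^ 2) ^ 2)) := by gcongr
      _ = 81 * (r ^ 2 - ‖c‖ ^ 2) ^ 2 * (‖H c‖ ^ 2 * (‖b c‖ ^ 4) ^ 2 / (1 + ‖a c‖ ^ 2) ^ 2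
          + ‖H c‖ ^ 2 * (‖a c‖ ^ 4) ^ 2 / (1 + ‖b c‖ ^ 2) ^ 2) := by ring
      _ ≤ 81 * (r ^ 2 - ‖c‖ ^ 2) ^ 2 * (2 * (r ^ 2 / (r ^ 2 - ‖c‖ ^ 2) ^ 2)) := by gcongr
      _ = 162 * r ^ 2 := by field_simp; ring
  · rw [hEdef]
    simp only
    rw [one_add_conj_mul_self, one_add_conj_mul_self, hden]
    refine mul_ne_zero (mul_ne_zero (mul_ne_zero hHc (pow_ne_zero _ hden0)) ?_) ?_
    · exact Complex.ofReal_ne_zero.mpr (hpos _).ne'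
    · exact Complex.ofReal_ne_zero.mpr (hpos _).ne'
  · have hin : ∀ᶠ z in 𝓝 c, z ∈ closedBall (0 : ℂ) r :=
      closedBall_mem_nhds_of_mem (by simpa using hcr)
    filter_upwards [hev, hin] with z hz hzr
    obtain ⟨h1, h2, h3⟩ := hz
    have e1 : ‖1 + starRingEnd ℂ (a c) * a z‖ ^ 2 * (1 + ‖(a z - a c) /
        (1 + starRingEnd ℂ (a c) * a z)‖ ^ 2) = (1 + ‖a z‖ ^ 2) * (1 + ‖a c‖ ^ 2) := by
      rw [normSq_identity_add, norm_div]
      have := norm_ne_zero_iff.mpr h1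
      field_simp
    have e2 : ‖1 + starRingEnd ℂ (b c) * b z‖ ^ 2 * (1 + ‖(b z - b c) /
        (1 + starRingEnd ℂ (b c) * b z)‖ ^ 2) = (1 + ‖b z‖ ^ 2) * (1 + ‖b c‖ ^ 2) := by
      rw [normSq_identity_add, norm_div]
      have := norm_ne_zero_iff.mpr h2
      field_simp
    have e3 : ‖(r : ℂ) ^ 2 - starRingEnd ℂ c * z‖ ^ 2 * (1 - ‖(r : ℂ) * (z - c) /
        ((r : ℂ) ^ 2 - starRingEnd ℂ c * z)‖ ^ 2) = (r ^ 2 - ‖z‖ ^ 2) * (r ^ 2 - ‖c‖ ^ 2) := by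
      rw [normSq_identity_sub, norm_div]
      have := norm_ne_zero_iff.mpr h3
      field_simp
    rw [hEc]
    set X := 1 - ‖(r : ℂ) * (z - c) / ((r : ℂ) ^ 2 - starRingEnd ℂ c * z)‖ ^ 2
    set Y := 1 + ‖(a z - a c) / (1 + starRingEnd ℂ (a c) * a z)‖ ^ 2
    set Z := 1 + ‖(b z - b c) / (1 + starRingEnd ℂ (b c) * b z)‖ ^ 2
    calc ‖E z‖ ^ 2 * X ^ 2 * Y * Z
        = ‖H z‖ ^ 2 * (‖(r : ℂ) ^ 2 - starRingEnd ℂ c * z‖ ^ 2 * X) ^ 2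
          * (‖1 + starRingEnd ℂ (a c) * a z‖ ^ 2 * Y)
          * (‖1 + starRingEnd ℂ (b c) * b z‖ ^ 2 * Z) := by
          simp only [hEdef, norm_mul, norm_pow]; ring
      _ = v z * ((r ^ 2 - ‖c‖ ^ 2) ^ 2 * (1 + ‖a c‖ ^ 2) * (1 + ‖b c‖ ^ 2)) := by
          rw [e1, e2, e3]; simp only [hv]; ring
      _ ≤ v c * ((r ^ 2 - ‖c‖ ^ 2) ^ 2 * (1 + ‖a c‖ ^ 2) * (1 + ‖b c‖ ^ 2)) :=
          mul_le_mul_of_nonneg_right (hmax hzr) (by positivity)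

/-- A holomorphic function without zeros on a disc has a fifth root there, namely `exp (L / 5)` for
a primitive `L` of the logarithmic derivative. -/
theorem exists_fifth_root {f : ℂ → ℂ} {R : ℝ} (hf : DifferentiableOn ℂ f (ball 0 R))
    (h0 : ∀ z ∈ ball 0 R, f z ≠ 0) :
    ∃ g : ℂ → ℂ, DifferentiableOn ℂ g (ball 0 R) ∧ ∀ z ∈ ball 0 R, g z ^ 5 = f z := by
  rcases (ball (0 : ℂ) R).eq_empty_or_nonempty with he | ⟨w, hw⟩
  · exact ⟨0, by simp [he], by simp [he]⟩
  have hd : DifferentiableOn ℂ (fun z => deriv f z / f z) (ball 0 R) :=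
    (hf.deriv isOpen_ball).div hf h0
  obtain ⟨L, hLw, hL⟩ := hd.isExactOn_ball.with_val_at w (Complex.log (f w))
  have hLd : ∀ z ∈ ball 0 R, HasDerivAt (fun z => f z * Complex.exp (-L z)) 0 z := by
    intro z hz
    have h1 := (hf.differentiableAt (isOpen_ball.mem_nhds hz)).hasDerivAt
    refine (h1.mul (hL z hz).neg.cexp).congr_deriv ?_
    have := h0 z hz
    field_simp
    ring
  have hconst : ∀ z ∈ ball 0 R, f z * Complex.exp (-L z) = f w * Complex.exp (-L w) := fun z hz =>
    isOpen_ball.is_const_of_deriv_eq_zero (convex_ball _ _).isPreconnected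
      (fun z hz => (hLd z hz).differentiableAt.differentiableWithinAt)
      (fun z hz => (hLd z hz).deriv) hz hw
  refine ⟨fun z => Complex.exp (L z / 5), fun z hz =>
    ((hL z hz).div_const 5).cexp.differentiableAt.differentiableWithinAt, fun z hz => ?_⟩
  have h1 := hconst z hz
  rw [hLw, Complex.exp_neg (Complex.log _), Complex.exp_log (h0 w hw), mul_inv_cancel₀ (h0 w hw),
    Complex.exp_neg, mul_inv_eq_one₀ (Complex.exp_ne_zero _)] at h1
  rw [h1, ← Complex.exp_nat_mul]
  congr 1
  push_cast
  ring

/-- A bound for the spherical derivative of holomorphic functions omitting `0` and `1`. -/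
theorem norm_deriv_le_of_omits {f : ℂ → ℂ} {R : ℝ} (hf : DifferentiableOn ℂ f (ball 0 R))
    (h0 : ∀ z ∈ ball 0 R, f z ≠ 0) (h1 : ∀ z ∈ ball 0 R, f z ≠ 1) {z : ℂ}
    (hz : z ∈ ball 0 (R / 4)) :
    ‖deriv f z‖ ≤ 2000 / R * (1 + ‖f z‖ ^ 2) := by
  have hzR : ‖z‖ < R / 4 := by simpa using hz
  have hR : 0 < R := by linarith [norm_nonneg z]
  have hzb : z ∈ ball (0 : ℂ) R := by simpa using hzR.trans (by linarith)
  obtain ⟨a, ha, haf⟩ := exists_fifth_root hf h0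
  obtain ⟨b, hb, hbf⟩ := exists_fifth_root (f := fun z => f z - 1) (hf.sub_const 1)
    (fun z hz => sub_ne_zero.mpr (h1 z hz))
  have hda : ∀ w ∈ ball 0 R, deriv f w = 5 * a w ^ 4 * deriv a w := by
    intro w hw
    have hw' : ball (0 : ℂ) R ∈ 𝓝 w := isOpen_ball.mem_nhds hw
    have e : f =ᶠ[𝓝 w] fun z => a z ^ 5 := by
      filter_upwards [hw'] with z hz using (haf z hz).symm
    rw [e.deriv_eq]
    exact (((ha.differentiableAt hw').hasDerivAt).pow 5).deriv
  have hdb : ∀ w ∈ ball 0 R, deriv f w = 5 * b w ^ 4 * deriv b w := by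
    intro w hw
    have hw' : ball (0 : ℂ) R ∈ 𝓝 w := isOpen_ball.mem_nhds hw
    have e : f =ᶠ[𝓝 w] fun z => b z ^ 5 + 1 := by
      filter_upwards [hw'] with z hz
      rw [hbf z hz]
      ring
    rw [e.deriv_eq]
    exact ((((hb.differentiableAt hw').hasDerivAt).pow 5).add_const 1).deriv
  have ha0 : ∀ w ∈ ball 0 R, a w ≠ 0 := fun w hw h => h0 w hw (by rw [← haf w hw, h]; simp)
  have hb0 : ∀ w ∈ ball 0 R, b w ≠ 0 := fun w hw h =>
    sub_ne_zero.mpr (h1 w hw) (by rw [← hbf w hw, h]; simp)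
  set H : ℂ → ℂ := fun w => deriv a w / b w ^ 4 with hH
  have hkey := ahlfors_schwarz (a := a) (b := b) (H := H) (R := R) (r := R / 2) (by linarith) ha hb
    ((ha.deriv isOpen_ball).div (hb.pow 4) fun w hw => pow_ne_zero _ (hb0 w hw))
    (fun w hw => by rw [haf w hw, hbf w hw]; ring)
    (fun w hw => (div_mul_cancel₀ _ (pow_ne_zero _ (hb0 w hw))).symm)
    (fun w hw => by
      have e := (hda w hw).symm.trans (hdb w hw)
      have := hb0 w hw
      rw [hH]
      simp only
      field_simp
      linear_combination -(1 / 5) * e) (z := z) (by simpa using hzR.le.trans (by linarith))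
  have hfz : deriv f z = 5 * a z ^ 4 * b z ^ 4 * H z := by
    have := hb0 z hzb
    rw [hda z hzb, hH]
    field_simp
  have hfa : ‖f z‖ = ‖a z‖ ^ 5 := by rw [← haf z hzb, norm_pow]
  have hba : ‖b z‖ ^ 5 ≤ 1 + ‖a z‖ ^ 5 := by
    rw [← norm_pow, ← norm_pow, hbf z hzb, haf z hzb]
    calc ‖f z - 1‖ ≤ ‖f z‖ + ‖(1 : ℂ)‖ := norm_sub_le _ _
      _ = _ := by rw [norm_one, add_comm]
  rw [hfz, hfa]
  simp only [norm_mul, norm_pow, Complex.norm_ofNat]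
  have hA := norm_nonneg (a z)
  have hB := norm_nonneg (b z)
  have hK := norm_nonneg (H z)
  set A := ‖a z‖
  set B := ‖b z‖
  set K := ‖H z‖
  have hBA : B ≤ 1 + A := by
    refine le_of_pow_le_pow_left₀ (n := 5) (by norm_num) (by positivity) (hba.trans ?_)
    have : 0 ≤ 5 * A + 10 * A ^ 2 + 10 * A ^ 3 + 5 * A ^ 4 := by positivity
    nlinarith
  have hd : 3 / 16 * R ^ 2 ≤ (R / 2) ^ 2 - ‖z‖ ^ 2 := by nlinarith [norm_nonneg z]
  have hK2 : (3 / 16 * R ^ 2) ^ 2 * K ^ 2 * (1 + A ^ 2) * (1 + B ^ 2) ≤ 162 * (R / 2) ^ 2 := by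
    refine le_trans ?_ hkey
    gcongr
  have hK3 : R ^ 2 * K ^ 2 * (1 + B ^ 2) ≤ 1200 := by
    have hR2 : 0 < R ^ 2 := by positivity
    have : R ^ 2 * K ^ 2 * (1 + B ^ 2) ≤ R ^ 2 * K ^ 2 * (1 + B ^ 2) * (1 + A ^ 2) :=
      le_mul_of_one_le_right (by positivity) (by nlinarith [sq_nonneg A])
    refine this.trans (le_of_mul_le_mul_left (a := 9 / 256 * R ^ 2) ?_ (by positivity))
    nlinarith
  have hAB : A ^ 8 * (1 + A) ^ 6 ≤ 64 * (1 + (A ^ 5) ^ 2) ^ 2 := by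
    rcases le_total A 1 with h | h
    · calc A ^ 8 * (1 + A) ^ 6 ≤ 1 ^ 8 * (1 + 1) ^ 6 := by gcongr
        _ ≤ 64 * (1 + 0) ^ 2 := by norm_num
        _ ≤ _ := by gcongr; positivity
    · calc A ^ 8 * (1 + A) ^ 6 ≤ A ^ 8 * (A + A) ^ 6 := by gcongr
        _ = 64 * A ^ 14 := by ring
        _ ≤ 64 * A ^ 20 := by gcongr; norm_num
        _ = 64 * (0 + (A ^ 5) ^ 2) ^ 2 := by ring
        _ ≤ _ := by gcongr; norm_num
  rw [div_mul_eq_mul_div, le_div_iff₀ hR]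
  refine le_of_pow_le_pow_left₀ (n := 2) (by norm_num) (by positivity) ?_
  calc (5 * A ^ 4 * B ^ 4 * K * R) ^ 2 = 25 * A ^ 8 * B ^ 6 * (R ^ 2 * K ^ 2 * B ^ 2) := by ring
    _ ≤ 25 * A ^ 8 * (1 + A) ^ 6 * (R ^ 2 * K ^ 2 * (1 + B ^ 2)) := by
      gcongr
      linarith
    _ ≤ 25 * A ^ 8 * (1 + A) ^ 6 * 1200 := by gcongr
    _ = 30000 * (A ^ 8 * (1 + A) ^ 6) := by ring
    _ ≤ 30000 * (64 * (1 + (A ^ 5) ^ 2) ^ 2) := by gcongr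
    _ ≤ (2000 * (1 + (A ^ 5) ^ 2)) ^ 2 := by
      have : 0 ≤ (1 + (A ^ 5) ^ 2) ^ 2 := by positivity
      nlinarith

/-- A bound for the spherical derivative gives a chordal Lipschitz estimate. -/
theorem dist_coe_le_of_norm_deriv_le {f : ℂ → ℂ} {c : ℂ} {ρ K : ℝ}
    (hf : ∀ z ∈ ball c ρ, DifferentiableAt ℂ f z)
    (hK : ∀ z ∈ ball c ρ, ‖deriv f z‖ ≤ K * (1 + ‖f z‖ ^ 2)) {z w : ℂ} (hz : z ∈ ball c ρ)
    (hw : w ∈ ball c ρ) : dist (f z : Sphere) (f w) ≤ (2 * K + 1) * dist z w := by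
  rcases eq_or_ne z w with rfl | hzw
  · simp
  set γ : ℝ → ℂ := fun t => z + t * (w - z) with hγ
  have hγmem : ∀ t ∈ Icc (0 : ℝ) 1, γ t ∈ ball c ρ := by
    intro t ht
    have := (convex_ball c ρ).add_smul_sub_mem hz hw ht
    simpa [hγ] using this
  have hFd : ∀ t ∈ Icc (0 : ℝ) 1,
      HasDerivAt (fun s => f (γ s)) (deriv f (γ t) * (w - z)) t := by
    intro t ht
    have h1 : HasDerivAt γ (w - z) t := by
      have := ((Complex.ofRealCLM.hasDerivAt (x := t)).mul_const (w - z)).const_add z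
      simpa only [one_mul, Complex.ofRealCLM_apply, Complex.ofReal_one] using this
    exact (hf _ (hγmem t ht)).hasDerivAt.comp t h1
  set G : ℝ → WithLp 2 (ℂ × ℝ) := fun t => stereo (f (γ t)) - stereo (f z) with hG
  have hGc : ContinuousOn G (Icc 0 1) := by
    refine ContinuousOn.sub ?_ continuousOn_const
    exact continuous_stereo.comp_continuousOn (OnePoint.continuous_coe.comp_continuousOn
      fun t ht => (hFd t ht).continuousAt.continuousWithinAt)
  have hd : 0 < dist z w := dist_pos.mpr hzw
  have hmain := image_norm_le_of_liminf_right_slope_norm_lt_deriv_boundary hGc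
    (f' := fun _ => 2 * K * dist z w) (B := fun t => (2 * K + 1) * dist z w * t)
    (B' := fun _ => (2 * K + 1) * dist z w) ?_ (by simp [hG, hγ])
    (by fun_prop) (fun x _ => by
      simpa using ((hasDerivAt_id x).const_mul ((2 * K + 1) * dist z w)).hasDerivWithinAt)
    (fun _ _ _ => by nlinarith) (right_mem_Icc.mpr zero_le_one)
  · have e : ‖G 1‖ = dist (f z : Sphere) (f w) := by
      simp only [hG, hγ, ← dist_eq_norm]
      rw [dist_comm]
      norm_num
      rfl
    rw [← e]
    simpa using hmain
  · intro t ht r hr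
    have ht' := Ico_subset_Icc_self ht
    -- the chordal difference quotients converge to the spherical derivative
    have hlim : Tendsto (fun s => 2 * ‖slope (fun s => f (γ s)) t s‖ /
        (√(1 + ‖f (γ s)‖ ^ 2) * √(1 + ‖f (γ t)‖ ^ 2))) (𝓝[>] t)
        (𝓝 (2 * ‖deriv f (γ t) * (w - z)‖ /
          (√(1 + ‖f (γ t)‖ ^ 2) * √(1 + ‖f (γ t)‖ ^ 2)))) := by
      have h1 := ((hasDerivAt_iff_tendsto_slope.mp (hFd t ht')).mono_left
        (nhdsWithin_mono t fun s (hs : t < s) => hs.ne')).norm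
      have h2 : Tendsto (fun s => f (γ s)) (𝓝[>] t) (𝓝 (f (γ t))) :=
        (hFd t ht').continuousAt.tendsto.mono_left nhdsWithin_le_nhds
      refine (h1.const_mul 2).div ((((h2.norm.pow 2).const_add 1).sqrt).mul_const _) ?_
      positivity
    have hle : 2 * ‖deriv f (γ t) * (w - z)‖ /
          (√(1 + ‖f (γ t)‖ ^ 2) * √(1 + ‖f (γ t)‖ ^ 2)) ≤ 2 * K * dist z w := by
      rw [Real.mul_self_sqrt (by positivity), div_le_iff₀ (by positivity), norm_mul,
        dist_comm, dist_eq_norm]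
      have := hK _ (hγmem t ht')
      have := mul_le_mul_of_nonneg_right this (norm_nonneg (w - z))
      linarith
    refine Eventually.frequently ?_
    filter_upwards [hlim.eventually_lt_const (hle.trans_lt hr), self_mem_nhdsWithin] with s hs hts
    refine lt_of_le_of_lt ?_ hs
    have hst : 0 < s - t := sub_pos.mpr hts
    have h3 : ‖G s‖ - ‖G t‖ ≤ dist (f (γ s) : Sphere) (f (γ t)) := by
      refine (norm_sub_norm_le _ _).trans_eq ?_
      simp only [hG, sub_sub_sub_cancel_right, ← dist_eq_norm]
      rfl
    rw [dist_eq_chordalDist] at h3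
    change _ ≤ 2 * ‖f (γ s) - f (γ t)‖ / (√(1 + ‖f (γ s)‖ ^ 2) * √(1 + ‖f (γ t)‖ ^ 2)) at h3
    rw [slope_def_field, slope_def_module, norm_smul, norm_inv, Real.norm_of_nonneg hst.le,
      Function.comp_apply, Function.comp_apply]
    refine (div_le_div_of_nonneg_right h3 hst.le).trans_eq ?_
    field_simp

end

noncomputable section

/-! ### Normality and equicontinuity -/

theorem equicontinuousAt_of_isNormalOn {F : ℕ → Sphere → Sphere} (hF : ∀ n, Continuous (F n))
    {U : Set Sphere} (hU : IsOpen U) (hN : IsNormalOn (range F) U) {y : Sphere} (hy : y ∈ U) :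
    EquicontinuousAt F y := by
  rw [Metric.equicontinuousAt_iff]
  -- a sequence of points witnessing failure contradicts the continuity of the uniform limit of a
  -- subsequence of the corresponding maps
  by_contra! hcon
  obtain ⟨ε, hε, hcon⟩ := hcon
  choose x hx i hi using fun k : ℕ => hcon (1 / (k + 1)) (by positivity)
  obtain ⟨K, hK, hKU, hKc⟩ := local_compact_nhds (hU.mem_nhds hy)
  obtain ⟨φ, hφ, g, hg⟩ := hN (fun k => F (i k)) (fun k => ⟨_, rfl⟩)
  obtain ⟨N, hN⟩ := hg K hKU hKc (ε / 5) (by positivity)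
  simp only [← dist_eq_chordalDist] at hN
  have hxt : Tendsto (fun j => x (φ j)) atTop (𝓝 y) := by
    rw [tendsto_iff_dist_tendsto_zero]
    exact squeeze_zero (fun _ => dist_nonneg) (fun j => (hx (φ j)).le)
      (tendsto_one_div_add_atTop_nhds_zero_nat.comp hφ.tendsto_atTop)
  have hc : ∀ᶠ z in 𝓝 y, dist (F (i (φ N)) z) (F (i (φ N)) y) < ε / 5 :=
    Metric.tendsto_nhds.mp ((hF (i (φ N))).tendsto y) _ (by positivity)
  obtain ⟨j, hj, hjK, hjN⟩ :=
    ((hxt.eventually hc).and ((hxt.eventually hK).and (eventually_ge_atTop N))).exists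
  have hyK := mem_of_mem_nhds hK
  have h1 := hN j hjN _ hjK
  have h2 := hN j hjN _ hyK
  have h3 := hN N le_rfl _ hjK
  have h4 := hN N le_rfl _ hyK
  have h5 := hi (φ j)
  have h6 := dist_triangle4 (g (x (φ j))) (F (i (φ N)) (x (φ j))) (F (i (φ N)) y) (g y)
  have h7 := dist_triangle4 (F (i (φ j)) y) (g y) (g (x (φ j))) (F (i (φ j)) (x (φ j)))
  rw [dist_comm] at h1 h3
  rw [dist_comm (g y)] at h7
  linarith

theorem isNormalOn_of_equicontinuousAt {F : ℕ → Sphere → Sphere} (hF : ∀ n, Continuous (F n))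
    {K : Set Sphere} (hK : IsCompact K) (h : ∀ y ∈ K, EquicontinuousAt F y) :
    IsNormalOn (range F) K := by
  intro f hf
  choose s hs using hf
  have : CompactSpace K := isCompact_iff_compactSpace.mp hK
  let u : ℕ → BoundedContinuousFunction K Sphere := fun n =>
    .mkOfCompact ⟨K.domRestrict (F n), (hF n).comp continuous_subtype_val⟩
  have hcomp : IsCompact (closure (range u)) := by
    refine BoundedContinuousFunction.arzela_ascoli univ isCompact_univ _
      (fun _ _ _ => mem_univ _) ?_
    intro y
    rw [Metric.equicontinuousAt_iff]
    intro ε hε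
    obtain ⟨δ, hδ, hd⟩ := Metric.equicontinuousAt_iff.mp (h y y.2) ε hε
    refine ⟨δ, hδ, ?_⟩
    rintro x hx ⟨_, n, rfl⟩
    exact hd x hx n
  obtain ⟨G, -, φ, hφ, hlim⟩ := hcomp.tendsto_subseq
    (x := fun n => u (s n)) (fun n => subset_closure ⟨_, rfl⟩)
  classical
  refine ⟨φ, hφ, fun x => if hx : x ∈ K then G ⟨x, hx⟩ else x, fun L hL _ ε hε => ?_⟩
  obtain ⟨N, hN⟩ := Metric.tendsto_atTop.mp hlim ε hε
  refine ⟨N, fun j hj x hx => ?_⟩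
  rw [← dist_eq_chordalDist, ← hs]
  simp only [hL hx, dif_pos]
  exact (BoundedContinuousFunction.dist_coe_le_dist (f := u (s (φ j))) (g := G)
    ⟨x, hL hx⟩).trans_lt (hN j hj)

theorem continuous_iterate_ratMap (R : RatFunc ℂ) (n : ℕ) : Continuous (ratMap R)^[n] :=
  (continuous_ratMap R).iterate n

/-- The Fatou set in terms of equicontinuity. Unlike normality this involves no subsequences and is
a statement about single points and their neighbourhoods. -/
theorem mem_fatou_iff (R : RatFunc ℂ) (z : Sphere) :
    z ∈ fatou R ↔ ∀ᶠ y in 𝓝 z, EquicontinuousAt (fun n => (ratMap R)^[n]) y := by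
  constructor
  · rintro ⟨U, hU, hz, hN⟩
    filter_upwards [hU.mem_nhds hz] with y hy
    exact equicontinuousAt_of_isNormalOn (continuous_iterate_ratMap R) hU hN hy
  · intro h
    obtain ⟨K, hK, hKU, hKc⟩ := local_compact_nhds h
    refine ⟨interior K, isOpen_interior, mem_interior_iff_mem_nhds.mpr hK, fun f hf => ?_⟩
    obtain ⟨φ, hφ, g, hg⟩ := isNormalOn_of_equicontinuousAt (continuous_iterate_ratMap R) hKc
      (fun y hy => hKU hy) f hf
    exact ⟨φ, hφ, g, fun L hL => hg L (hL.trans interior_subset)⟩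

theorem isOpen_fatou (R : RatFunc ℂ) : IsOpen (fatou R) := by
  rw [isOpen_iff_mem_nhds]
  intro z hz
  rw [mem_fatou_iff, ← eventually_eventually_nhds] at hz
  filter_upwards [hz] with y hy using (mem_fatou_iff R y).mpr hy

theorem isClosed_julia (R : RatFunc ℂ) : IsClosed (julia R) := (isOpen_fatou R).isClosed_compl

theorem image_fatou_subset_of_semiconj {R S : RatFunc ℂ} (φ : Sphere ≃ₜ Sphere)
    (h : ⇑φ ∘ ratMap R = ratMap S ∘ ⇑φ) {z : Sphere} (hz : z ∈ fatou R) : φ z ∈ fatou S := by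
  rw [mem_fatou_iff] at hz ⊢
  have hz' : ∀ᶠ y in 𝓝 (φ z), EquicontinuousAt (fun n => (ratMap R)^[n]) (φ.symm y) := by
    refine (φ.symm.continuous.tendsto (φ z)).eventually ?_
    rwa [φ.symm_apply_apply]
  filter_upwards [hz'] with y hy
  have hiter : ∀ (n : ℕ) (x : Sphere), (ratMap S)^[n] x = φ ((ratMap R)^[n] (φ.symm x)) := by
    intro n x
    have hs : Function.Semiconj φ (ratMap R) (ratMap S) := fun x => congrFun h x
    rw [(hs.iterate_right n).eq, φ.apply_symm_apply]
  rw [Metric.equicontinuousAt_iff_right] at hy ⊢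
  intro ε hε
  obtain ⟨δ, hδ, hd⟩ := Metric.uniformContinuous_iff.mp
    (CompactSpace.uniformContinuous_of_continuous φ.continuous) ε hε
  filter_upwards [(φ.symm.continuous.tendsto y).eventually (hy δ hδ)] with x hx n
  rw [hiter, hiter]
  exact hd (hx n)

theorem image_julia_of_semiconj {R S : RatFunc ℂ} (φ : Sphere ≃ₜ Sphere)
    (h : ⇑φ ∘ ratMap R = ratMap S ∘ ⇑φ) : φ '' julia R = julia S := by
  have h' : ⇑φ.symm ∘ ratMap S = ratMap R ∘ ⇑φ.symm := by
    funext x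
    have := congrFun h (φ.symm x)
    simp only [Function.comp_apply, φ.apply_symm_apply] at this
    simp [← this]
  ext y
  constructor
  · rintro ⟨x, hx, rfl⟩ hy
    refine hx ?_
    simpa using image_fatou_subset_of_semiconj φ.symm h' hy
  · intro hy
    refine ⟨φ.symm y, fun hx => hy ?_, φ.apply_symm_apply y⟩
    simpa using image_fatou_subset_of_semiconj φ h hx

/-! ### Rational maps in homogeneous coordinates -/

open Polynomial

/-- The value at `(a, b)` of the homogenization in degree `d` of a polynomial of
degree at most `d`. -/
def homEval (d : ℕ) (P : ℂ[X]) (a b : ℂ) : ℂ :=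
  ∑ i ∈ Finset.range (d + 1), P.coeff i * a ^ i * b ^ (d - i)

theorem homEval_of_ne {d : ℕ} {P : ℂ[X]} (hP : P.natDegree ≤ d) (a : ℂ) {b : ℂ} (hb : b ≠ 0) :
    homEval d P a b = b ^ d * P.eval (a / b) := by
  rw [homEval, eval_eq_sum_range' (Nat.lt_succ_of_le hP), Finset.mul_sum]
  refine Finset.sum_congr rfl fun i hi => ?_
  have hi : i ≤ d := Nat.lt_succ_iff.mp (Finset.mem_range.mp hi)
  rw [div_pow, ← Nat.sub_add_cancel hi, pow_add, Nat.add_sub_cancel]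
  field_simp

theorem homEval_zero_right (d : ℕ) (P : ℂ[X]) (a : ℂ) : homEval d P a 0 = P.coeff d * a ^ d := by
  rw [homEval, Finset.sum_range_succ, Finset.sum_eq_zero, zero_add]
  · simp
  · intro i hi
    have := Finset.mem_range.mp hi
    rw [zero_pow (by omega), mul_zero]

theorem eval_num_denom_ne (R : RatFunc ℂ) (z : ℂ) : R.num.eval z ≠ 0 ∨ R.denom.eval z ≠ 0 := by
  by_contra! hcon
  obtain ⟨u, v, huv⟩ := R.isCoprime_num_denom
  have := congrArg (Polynomial.eval z) huv
  simp [hcon.1, hcon.2] at this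

theorem coeff_degree_ne (R : RatFunc ℂ) :
    R.num.coeff (degree R) ≠ 0 ∨ R.denom.coeff (degree R) ≠ 0 := by
  rcases le_total R.num.natDegree R.denom.natDegree with h | h
  · right
    rw [degree, max_eq_right h]
    exact leadingCoeff_ne_zero.mpr R.denom_ne_zero
  · rw [degree, max_eq_left h]
    rcases eq_or_ne R.num 0 with h0 | h0
    · right
      have : R.denom.natDegree = 0 := by simpa [h0] using h
      rw [h0, natDegree_zero, ← this]
      exact leadingCoeff_ne_zero.mpr R.denom_ne_zero
    · exact Or.inl (leadingCoeff_ne_zero.mpr h0)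

theorem natDegree_num_le (R : RatFunc ℂ) : R.num.natDegree ≤ degree R := le_max_left _ _

theorem natDegree_denom_le (R : RatFunc ℂ) : R.denom.natDegree ≤ degree R := le_max_right _ _

theorem homEval_ne (R : RatFunc ℂ) {a b : ℂ} (h : a ≠ 0 ∨ b ≠ 0) :
    homEval (degree R) R.num a b ≠ 0 ∨ homEval (degree R) R.denom a b ≠ 0 := by
  by_cases hb : b = 0
  · have ha : a ≠ 0 := h.resolve_right (by simpa using hb)
    subst hb
    simpa [homEval_zero_right, ha] using coeff_degree_ne R
  · rw [homEval_of_ne (natDegree_num_le R) _ hb, homEval_of_ne (natDegree_denom_le R) _ hb]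
    simpa [hb] using eval_num_denom_ne R (a / b)

theorem ratio_mul_left {c : ℂ} (hc : c ≠ 0) (a b : ℂ) : ratio (c * a) (c * b) = ratio a b := by
  simp [ratio, hc, mul_div_mul_left]

theorem ratMap_coe (R : RatFunc ℂ) (z : ℂ) :
    ratMap R (z : Sphere) = ratio (R.num.eval z) (R.denom.eval z) := rfl

theorem ratMap_infty (R : RatFunc ℂ) : ratMap R OnePoint.infty =
    ratio (R.num.coeff (degree R)) (R.denom.coeff (degree R)) := rfl

theorem ratMap_ratio (R : RatFunc ℂ) {a b : ℂ} (h : a ≠ 0 ∨ b ≠ 0) : ratMap R (ratio a b) =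
    ratio (homEval (degree R) R.num a b) (homEval (degree R) R.denom a b) := by
  by_cases hb : b = 0
  · have ha : a ≠ 0 := h.resolve_right (by simpa using hb)
    rw [hb, ratio_zero, ratMap_infty, homEval_zero_right, homEval_zero_right, mul_comm,
      mul_comm (R.denom.coeff _), ratio_mul_left (pow_ne_zero _ ha)]
  · rw [homEval_of_ne (natDegree_num_le R) _ hb, homEval_of_ne (natDegree_denom_le R) _ hb,
      ratio_mul_left (pow_ne_zero _ hb), ratio_of_ne hb, ratMap_coe]

theorem analyticAt_homEval {a b : ℂ → ℂ} {z : ℂ} (d : ℕ) (P : ℂ[X]) (ha : AnalyticAt ℂ a z)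
    (hb : AnalyticAt ℂ b z) : AnalyticAt ℂ (fun w => homEval d P (a w) (b w)) z := by
  unfold homEval
  exact Finset.analyticAt_fun_sum _ fun i _ => (analyticAt_const.mul (ha.pow i)).mul (hb.pow _)

theorem HoloAt.ratMap {f : ℂ → Sphere} {z : ℂ} (hf : HoloAt f z) (R : RatFunc ℂ) :
    HoloAt (fun w => ratMap R (f w)) z := by
  obtain ⟨a, b, ha, hb, h, hev⟩ := hf
  refine ⟨_, _, analyticAt_homEval (degree R) R.num ha hb,
    analyticAt_homEval (degree R) R.denom ha hb, homEval_ne R h, ?_⟩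
  filter_upwards [hev, eventually_ne_or_ne ha hb h] with w hw hne
  rw [hw, ratMap_ratio R hne]

theorem HoloAt.iterate_ratMap {f : ℂ → Sphere} {z : ℂ} (hf : HoloAt f z) (R : RatFunc ℂ) (n : ℕ) :
    HoloAt (fun w => (RationalDynamics.ratMap R)^[n] (f w)) z := by
  induction n with
  | zero => exact hf
  | succ n ih =>
    simp only [Function.iterate_succ_apply']
    exact ih.ratMap R

/-! ### Fibres, fixed points, openness and surjectivity -/

theorem finite_preimage_coe {s : Set Sphere} (h : {z : ℂ | (z : Sphere) ∈ s}.Finite) :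
    s.Finite := by
  refine ((h.image OnePoint.some).union (finite_singleton OnePoint.infty)).subset ?_
  intro x hx
  induction x using OnePoint.rec with
  | infty => exact Or.inr rfl
  | coe z => exact Or.inl ⟨z, hx, rfl⟩

theorem finite_fibre (R : RatFunc ℂ) (hR : 1 ≤ degree R) (w : Sphere) :
    (ratMap R ⁻¹' {w}).Finite := by
  obtain ⟨c, d, hcd, rfl⟩ := exists_ratio w
  refine finite_preimage_coe ?_
  -- the finite part of the fibre is the zero set of `d P - c Q`; if this polynomial vanished,
  -- coprimality would make `P` and `Q` constant
  have hne : C d * R.num - C c * R.denom ≠ 0 := by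
    intro h0
    have h1 : C d * R.num = C c * R.denom := sub_eq_zero.mp h0
    have hu : ∀ {P Q : ℂ[X]} {u v : ℂ}, IsCoprime P Q → u ≠ 0 → C u * P = C v * Q →
        Q.natDegree = 0 := by
      intro P Q u v hPQ hu h
      have hdvd : Q ∣ P := by
        have : Q ∣ C u * P := ⟨C v, by rw [h, mul_comm]⟩
        have := this.mul_left (C u⁻¹)
        rwa [← mul_assoc, ← C_mul, inv_mul_cancel₀ hu, C_1, one_mul] at this
      exact natDegree_eq_zero_of_isUnit (hPQ.symm.isUnit_of_dvd' dvd_rfl hdvd)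
    have hco := R.isCoprime_num_denom
    have hn : degree R = 0 := by
      rcases eq_or_ne d 0 with rfl | hd
      · have hc : c ≠ 0 := hcd.resolve_right (by simp)
        have : R.denom = 0 := by simpa [hc] using h1.symm
        exact absurd this R.denom_ne_zero
      · have hq := hu hco hd h1
        rcases eq_or_ne c 0 with rfl | hc
        · have : R.num = 0 := by simpa [hd] using h1
          simp [degree, this, hq]
        · have hp := hu hco.symm hc h1.symm
          simp [degree, hp, hq]
    omega
  refine (C d * R.num - C c * R.denom).rootSet_finite ℂ |>.subset ?_
  intro z hz
  have hz' : ratio (R.num.eval z) (R.denom.eval z) = ratio c d := hz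
  rw [ratio_eq_ratio_iff (eval_num_denom_ne R z) hcd] at hz'
  rw [mem_rootSet]
  refine ⟨hne, ?_⟩
  simp only [map_sub, map_mul, coe_aeval_eq_eval, eval_C]
  linear_combination hz'

/-- The polynomial whose roots are the finite fixed points. -/
def fixedPoly (R : RatFunc ℂ) : ℂ[X] := X * R.denom - R.num

theorem fixedPoly_ne_zero (R : RatFunc ℂ) (hR : 2 ≤ degree R) : fixedPoly R ≠ 0 := by
  intro h0
  have h1 : R.num = X * R.denom := (sub_eq_zero.mp h0).symm
  have hdvd : R.denom ∣ R.num := ⟨X, by rw [h1, mul_comm]⟩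
  have hd := natDegree_eq_zero_of_isUnit (R.isCoprime_num_denom.symm.isUnit_of_dvd' dvd_rfl hdvd)
  have : R.num.natDegree ≤ 1 := by
    rw [h1]
    refine natDegree_mul_le.trans ?_
    rw [natDegree_X, hd]
  rw [degree] at hR
  omega

theorem ratMap_coe_eq_self_iff (R : RatFunc ℂ) (z : ℂ) :
    ratMap R (z : Sphere) = z ↔ (fixedPoly R).eval z = 0 := by
  rw [ratMap_coe, ← ratio_one z, ratio_eq_ratio_iff (eval_num_denom_ne R z) (by simp), mul_one,
    fixedPoly, eval_sub, eval_mul, eval_X, sub_eq_zero, eq_comm]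

theorem finite_fixedPoints (R : RatFunc ℂ) (hR : 2 ≤ degree R) :
    {x | ratMap R x = x}.Finite := by
  refine finite_preimage_coe ((fixedPoly R).rootSet_finite ℂ |>.subset ?_)
  intro z hz
  rw [mem_rootSet]
  exact ⟨fixedPoly_ne_zero R hR, by
    rw [coe_aeval_eq_eval]; exact (ratMap_coe_eq_self_iff R z).mp hz⟩

/-- A holomorphic map to the sphere that is not constant near a point is open there. -/
theorem HoloAt.nhds_le_map {f : ℂ → Sphere} {z : ℂ} (hf : HoloAt f z)
    (hne : ¬ ∀ᶠ w in 𝓝 z, f w = f z) : 𝓝 (f z) ≤ map f (𝓝 z) := by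
  obtain ⟨g, hg⟩ := exists_mobius_zero (f z)
  have hg' : RationalDynamics.mobius g⁻¹ (f z) = ((0 : ℂ) : Sphere) := by
    rw [← hg, ← mobius_symm, Homeomorph.symm_apply_apply]
  have hh := hf.mobius g⁻¹
  have hfin : RationalDynamics.mobius g⁻¹ (f z) ≠ ratio 1 0 := by
    rw [hg', ratio_zero]
    exact OnePoint.coe_ne_infty 0
  have han := hh.analyticAt hfin
  have hcont : ContinuousAt (fun w => RationalDynamics.mobius g⁻¹ (f w)) z := by
    obtain ⟨a, b, ha, hb, h, hev⟩ := hh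
    have := tendsto_ratio ha.continuousAt.tendsto hb.continuousAt.tendsto h
    rw [← hev.self_of_nhds] at this
    exact this.congr' (hev.mono fun w hw => hw.symm)
  have hev : ∀ᶠ w in 𝓝 z, ((toPlane (RationalDynamics.mobius g⁻¹ (f w)) : ℂ) : Sphere) =
      RationalDynamics.mobius g⁻¹ (f w) :=
    (hcont.eventually_ne hfin).mono fun w hw => coe_toPlane hw
  have hback : ∀ᶠ w in 𝓝 z, f w = RationalDynamics.mobius g
      ((toPlane (RationalDynamics.mobius g⁻¹ (f w)) : ℂ) : Sphere) := by
    filter_upwards [hev] with w hw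
    rw [hw, ← mobius_symm, Homeomorph.apply_symm_apply]
  rcases han.eventually_constant_or_nhds_le_map_nhds with hc | ho
  · refine absurd ?_ hne
    filter_upwards [hback, hc] with w hw hw'
    rw [hw, hw', ← hback.self_of_nhds]
  · have h1 : map f (𝓝 z) = map (fun c : ℂ => RationalDynamics.mobius g (c : Sphere))
        (map (fun w => toPlane (RationalDynamics.mobius g⁻¹ (f w))) (𝓝 z)) := by
      rw [map_map]
      exact map_congr hback
    rw [h1]
    refine le_trans ?_ (map_mono ho)
    have h2 : (fun c : ℂ => RationalDynamics.mobius g (c : Sphere)) =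
      RationalDynamics.mobius g ∘ OnePoint.some := rfl
    rw [h2, ← map_map, ← OnePoint.nhds_coe_eq, (RationalDynamics.mobius g).map_nhds_eq,
      hev.self_of_nhds, ← mobius_symm, Homeomorph.apply_symm_apply]

theorem mobius_coe_isOpenEmbedding (g : GL (Fin 2) ℂ) :
    IsOpenEmbedding fun c : ℂ => mobius g (c : Sphere) :=
  (mobius g).isOpenEmbedding.comp OnePoint.isOpenEmbedding_coe

theorem isOpenMap_ratMap (R : RatFunc ℂ) (hR : 1 ≤ degree R) : IsOpenMap (ratMap R) := by
  rw [isOpenMap_iff_nhds_le]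
  intro x
  obtain ⟨g, hg⟩ := exists_mobius_zero x
  have hemb := mobius_coe_isOpenEmbedding g
  have hh : HoloAt (fun c : ℂ => ratMap R (mobius g (c : Sphere))) 0 :=
    ((holoAt_coe 0).mobius g).ratMap R
  have h1 := hh.nhds_le_map ?_
  · have h2 : (fun c : ℂ => ratMap R (mobius g (c : Sphere))) =
      ratMap R ∘ fun c : ℂ => mobius g (c : Sphere) := rfl
    rw [h2, ← map_map, hemb.map_nhds_eq] at h1
    rwa [hg] at h1
  · intro hc
    have hfin : {c : ℂ | ratMap R (mobius g (c : Sphere)) =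
        ratMap R (mobius g ((0 : ℂ) : Sphere))}.Finite :=
      (finite_fibre R hR (ratMap R (mobius g ((0 : ℂ) : Sphere)))).preimage hemb.injective.injOn
    exact infinite_of_mem_nhds (0 : ℂ) hc hfin

theorem surjective_ratMap (R : RatFunc ℂ) (hR : 1 ≤ degree R) : Function.Surjective (ratMap R) := by
  rw [← range_eq_univ]
  exact IsClopen.eq_univ ⟨(isCompact_range (continuous_ratMap R)).isClosed,
    (isOpenMap_ratMap R hR).isOpen_range⟩ (range_nonempty _)

/-- The Julia set is completely invariant: openness of the map transports equicontinuity at a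
point to its image. -/
theorem ratMap_mem_julia_iff (R : RatFunc ℂ) (hR : 1 ≤ degree R) (x : Sphere) :
    ratMap R x ∈ julia R ↔ x ∈ julia R := by
  refine ⟨fun h hx => h ?_, fun h => mapsTo_julia R h⟩
  rw [mem_fatou_iff] at hx ⊢
  refine (isOpenMap_ratMap R hR).nhds_le x ?_
  change ∀ᶠ y in 𝓝 x, EquicontinuousAt (fun n => (ratMap R)^[n]) (ratMap R y)
  filter_upwards [hx] with y hy
  rw [Metric.equicontinuousAt_iff_right] at hy ⊢
  intro ε hε
  refine (isOpenMap_ratMap R hR).nhds_le y ?_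
  change ∀ᶠ v in 𝓝 y, ∀ n, dist ((ratMap R)^[n] (ratMap R y)) ((ratMap R)^[n] (ratMap R v)) < ε
  filter_upwards [hy ε hε] with v hv n
  exact hv (n + 1)

end

noncomputable section

/-! ### Fixed points in the Julia set -/

open Polynomial

/-- `x` is a fixed point of the rational map with multiplier `l`: in a Möbius coordinate centred
at `x` the map is given by a holomorphic germ with derivative `l` at `0`. -/
def HasMultiplier (R : RatFunc ℂ) (x : Sphere) (l : ℂ) : Prop :=
  ∃ (g : GL (Fin 2) ℂ) (F : ℂ → ℂ), mobius g ((0 : ℂ) : Sphere) = x ∧ AnalyticAt ℂ F 0 ∧ F 0 = 0 ∧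
    HasDerivAt F l 0 ∧ ∀ᶠ w in 𝓝 (0 : ℂ), mobius g (F w : Sphere) = ratMap R (mobius g (w : Sphere))

theorem HasMultiplier.fixed {R : RatFunc ℂ} {x : Sphere} {l : ℂ} (h : HasMultiplier R x l) :
    ratMap R x = x := by
  obtain ⟨g, F, rfl, -, h0, -, hev⟩ := h
  rw [← hev.self_of_nhds, h0]

/-- The iterates of a germ `F w = l w + ⋯` are of the form `lⁿ w + ⋯`. -/
theorem iterate_germ_eq_mul {F : ℂ → ℂ} {l : ℂ} (hF : AnalyticAt ℂ F 0) (h0 : F 0 = 0)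
    (hl : HasDerivAt F l 0) (n : ℕ) : ∃ G : ℂ → ℂ, AnalyticAt ℂ G 0 ∧ G 0 = l ^ n ∧
      ∀ᶠ w in 𝓝 (0 : ℂ), F^[n] w = w ^ 1 * G w := by
  induction n with
  | zero => exact ⟨fun _ => 1, analyticAt_const, by simp, by simp⟩
  | succ n ih =>
    obtain ⟨G, hG, hG0, hev⟩ := ih
    have hFt : Tendsto F (𝓝 0) (𝓝 0) := by simpa [h0] using hF.continuousAt.tendsto
    have hd : AnalyticAt ℂ (dslope F 0) 0 := by
      obtain ⟨p, hp⟩ := hF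
      exact hp.has_fpower_series_dslope_fslope.analyticAt
    refine ⟨fun w => dslope F 0 w * G (F w), hd.mul (hG.comp_of_eq hF h0), ?_, ?_⟩
    · simp only [dslope_same, h0, hG0, hl.deriv]
      ring
    · filter_upwards [hFt.eventually hev] with w hw
      have h1 : F w = w * dslope F 0 w := by
        have := sub_smul_dslope F 0 w
        simpa [h0] using this.symm
      rw [Function.iterate_succ_apply, hw, h1]
      ring

/-- The iterates of a germ `F w = w + a wᵏ + ⋯`, with `2 ≤ k`, are of the form
`w + n a wᵏ + ⋯`. -/
theorem iterate_germ_eq_add {F G : ℂ → ℂ} {k : ℕ} (hk : 2 ≤ k) (hF : AnalyticAt ℂ F 0)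
    (h0 : F 0 = 0) (hG : AnalyticAt ℂ G 0) (hFG : ∀ᶠ w in 𝓝 (0 : ℂ), F w = w + w ^ k * G w)
    (n : ℕ) : ∃ H : ℂ → ℂ, AnalyticAt ℂ H 0 ∧ H 0 = n * G 0 ∧
      ∀ᶠ w in 𝓝 (0 : ℂ), F^[n] w = w + w ^ k * H w := by
  induction n with
  | zero => exact ⟨fun _ => 0, analyticAt_const, by simp, by simp⟩
  | succ n ih =>
    obtain ⟨H, hH, hH0, hev⟩ := ih
    have hFt : Tendsto F (𝓝 0) (𝓝 0) := by simpa [h0] using hF.continuousAt.tendsto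
    have hHF : AnalyticAt ℂ (fun w => H (F w)) 0 := hH.comp_of_eq hF h0
    obtain ⟨j, rfl⟩ : ∃ j, k = j + 2 := ⟨k - 2, by omega⟩
    have hprop : ∀ K : ℂ → ℂ, AnalyticAt ℂ K 0 →
        AnalyticAt ℂ (fun w => G w + (1 + w ^ (j + 1) * G w) ^ (j + 2) * K w) 0 :=
      fun K hK => by fun_prop
    refine ⟨fun w => G w + (1 + w ^ (j + 1) * G w) ^ (j + 2) * H (F w), hprop _ hHF, ?_, ?_⟩
    · simp only [h0, hH0]
      push_cast
      simp
      ring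
    · filter_upwards [hFt.eventually hev, hFG] with w hw hw'
      rw [Function.iterate_succ_apply, hw]
      have h1 : F w = w * (1 + w ^ (j + 1) * G w) := by rw [hw']; ring
      have h2 : F w ^ (j + 2) = w ^ (j + 2) * (1 + w ^ (j + 1) * G w) ^ (j + 2) := by
        rw [h1, mul_pow]
      rw [h2, hw']
      ring

/-- Cauchy's estimate for the first nonzero Taylor coefficient. -/
theorem norm_coeff_le {h G : ℂ → ℂ} {k : ℕ} {δ M : ℝ} (hδ : 0 < δ)
    (hh : DifferentiableOn ℂ h (Metric.ball 0 δ)) (hM : ∀ w ∈ Metric.ball 0 δ, ‖h w‖ ≤ M)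
    (hG : AnalyticAt ℂ G 0) (hev : ∀ᶠ w in 𝓝 (0 : ℂ), h w = w ^ (k + 1) * G w) :
    ‖G 0‖ ≤ M / δ ^ (k + 1) := by
  have h0 : h 0 = 0 := by rw [hev.self_of_nhds]; simp
  have ho : (fun w => h w - h 0) =o[𝓝 0] fun w : ℂ => ‖w - 0‖ ^ k := by
    have h1 : (fun w => w * G w) =o[𝓝 0] fun _ : ℂ => (1 : ℝ) := by
      rw [Asymptotics.isLittleO_one_iff]
      have : ContinuousAt (fun w => w * G w) 0 := by
        have := hG.continuousAt
        fun_prop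
      simpa using this.tendsto
    have h2 : (fun w : ℂ => w ^ k) =O[𝓝 0] fun w : ℂ => ‖w - 0‖ ^ k := by
      simp only [sub_zero, ← norm_pow]
      exact (Asymptotics.isBigO_refl _ _).norm_right
    refine (h2.mul_isLittleO h1).congr' ?_ ?_
    · filter_upwards [hev] with w hw
      rw [hw, h0]
      ring
    · simp
  have hbound : ∀ᶠ w in 𝓝[≠] (0 : ℂ), ‖G w‖ ≤ M / δ ^ (k + 1) := by
    rw [eventually_nhdsWithin_iff]
    filter_upwards [hev, Metric.ball_mem_nhds (0 : ℂ) hδ] with w hw hwδ hw0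
    have := Complex.dist_le_mul_div_pow_of_mapsTo_ball_of_isLittleO (n := k) hh
      (fun w hw => by rw [h0, mem_closedBall_zero_iff]; exact hM w hw) ho hwδ
    rw [h0, dist_zero_right, dist_zero_right, hw, norm_mul, norm_pow, div_pow,
      mul_div_assoc', mul_comm, ← div_mul_eq_mul_div] at this
    exact le_of_mul_le_mul_right this (pow_pos (norm_pos_iff.mpr hw0) _)
  exact le_of_tendsto (hG.continuousAt.norm.tendsto.mono_left nhdsWithin_le_nhds) hbound

/-- Repelling fixed points, and fixed points of multiplier one, lie in the Julia set: a Taylor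
coefficient of the iterates is unbounded, while equicontinuity would bound it. -/
theorem HasMultiplier.mem_julia {R : RatFunc ℂ} (hR : 2 ≤ degree R) {x : Sphere} {l : ℂ}
    (h : HasMultiplier R x l) (hl : 1 < ‖l‖ ∨ l = 1) : x ∈ julia R := by
  intro hx
  have hfix : ∀ n, (ratMap R)^[n] x = x := fun n => Function.iterate_fixed h.fixed n
  obtain ⟨g, F, hg, hF, h0, hd, hev⟩ := h
  have hemb := mobius_coe_isOpenEmbedding g
  set c : ℂ → Sphere := fun w => mobius g (w : Sphere) with hc
  have hFt : Tendsto F (𝓝 0) (𝓝 0) := by simpa [h0] using hF.continuousAt.tendsto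
  have hiter : ∀ n, ∀ᶠ w in 𝓝 (0 : ℂ), c (F^[n] w) = (ratMap R)^[n] (c w) := by
    intro n
    induction n with
    | zero => simp
    | succ n ih =>
      filter_upwards [hFt.eventually ih, hev] with w hw hw'
      rw [Function.iterate_succ_apply, Function.iterate_succ_apply, hw]
      exact congrArg _ hw'
  obtain ⟨δ, hδ, hmaps⟩ : ∃ δ > 0, ∀ w ∈ Metric.ball (0 : ℂ) δ, ∀ n, ∃ v : ℂ, ‖v‖ < 1 ∧
      (ratMap R)^[n] (c w) = c v := by
    have heq := ((mem_fatou_iff R x).mp hx).self_of_nhds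
    have himg : c '' Metric.ball 0 1 ∈ 𝓝 x := by
      rw [← hg]
      exact hemb.isOpenMap.image_mem_nhds (Metric.ball_mem_nhds 0 one_pos)
    obtain ⟨ε, hε, hεsub⟩ := Metric.mem_nhds_iff.mp himg
    have h1 := (Metric.equicontinuousAt_iff_right.mp heq) ε hε
    rw [← hg] at h1
    obtain ⟨δ, hδ, hsub⟩ := Metric.mem_nhds_iff.mp (hemb.continuous.continuousAt.eventually h1)
    refine ⟨δ, hδ, fun w hw n => ?_⟩
    have h2 := hsub hw n
    rw [hg, hfix, dist_comm] at h2
    obtain ⟨v, hv, hv'⟩ := hεsub (Metric.mem_ball.mpr h2)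
    exact ⟨v, by simpa using hv, hv'.symm⟩
  set H : ℕ → ℂ → ℂ := fun n w => toPlane (mobius g⁻¹ ((ratMap R)^[n] (c w))) with hH
  have hback : ∀ v, mobius g⁻¹ (c v) = (v : Sphere) := fun v => by
    rw [← mobius_symm, hc, Homeomorph.symm_apply_apply]
  have hHv : ∀ n w, ∀ v, (ratMap R)^[n] (c w) = c v → H n w = v := by
    intro n w v hv
    simp only [hH, hv, hback, toPlane_coe]
  have hHd : ∀ n, DifferentiableOn ℂ (H n) (Metric.ball 0 δ) := by
    intro n w hw
    obtain ⟨v, -, hv⟩ := hmaps w hw n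
    refine (HoloAt.analyticAt ((((holoAt_coe w).mobius g).iterate_ratMap R n).mobius g⁻¹) ?_
      ).differentiableAt.differentiableWithinAt
    have : (ratMap R)^[n] (mobius g (w : Sphere)) = c v := hv
    rw [this, hback, ratio_zero]
    exact OnePoint.coe_ne_infty v
  have hHb : ∀ n, ∀ w ∈ Metric.ball (0 : ℂ) δ, ‖H n w‖ ≤ 1 := by
    intro n w hw
    obtain ⟨v, hv1, hv⟩ := hmaps w hw n
    rw [hHv n w v hv]
    exact hv1.le
  have hHF : ∀ n, ∀ᶠ w in 𝓝 (0 : ℂ), H n w = F^[n] w := fun n =>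
    (hiter n).mono fun w hw => hHv n w _ hw.symm
  rcases hl with hl | rfl
  · have hb : ∀ n, ‖l‖ ^ n ≤ 1 / δ ^ (0 + 1) := by
      intro n
      obtain ⟨G, hG, hG0, hGev⟩ := iterate_germ_eq_mul hF h0 hd n
      rw [← norm_pow, ← hG0]
      refine norm_coeff_le hδ (hHd n) (hHb n) hG ?_
      filter_upwards [hHF n, hGev] with w h1 h2
      rw [h1, h2]
    obtain ⟨n, hn⟩ := pow_unbounded_of_one_lt (1 / δ ^ (0 + 1)) hl
    exact absurd (hb n) (not_le.mpr hn)
  · have hsub : AnalyticAt ℂ (fun w => F w - w) 0 := hF.sub analyticAt_id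
    -- `F` is not the identity since there are only finitely many fixed points
    have hne : ¬ ∀ᶠ w in 𝓝 (0 : ℂ), F w - w = 0 := by
      intro hz
      have hfp : {w : ℂ | ratMap R (c w) = c w}.Finite :=
        (finite_fixedPoints R hR).preimage hemb.injective.injOn
      refine infinite_of_mem_nhds (0 : ℂ) ?_ hfp
      filter_upwards [hz, hev] with w hw hw'
      rw [sub_eq_zero.mp hw] at hw'
      exact hw'.symm
    obtain ⟨k, G, hG, hG0, hGev⟩ := hsub.exists_eventuallyEq_pow_smul_nonzero_iff.mpr hne
    simp only [sub_zero, smul_eq_mul] at hGev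
    have hk : 2 ≤ k := by
      by_contra! hlt
      have hdd : HasDerivAt (fun w => F w - w) (1 - 1) 0 := hd.sub (hasDerivAt_id 0)
      have hdd' := hdd.congr_of_eventuallyEq (EventuallyEq.symm hGev)
      interval_cases k
      · have := hGev.self_of_nhds
        simp [h0] at this
        exact hG0 this.symm
      · have h2 := ((hasDerivAt_id (0 : ℂ)).pow 1).mul hG.differentiableAt.hasDerivAt
        have := hdd'.unique h2
        simp at this
        exact hG0 this.symm
    have hFG : ∀ᶠ w in 𝓝 (0 : ℂ), F w = w + w ^ k * G w := by
      filter_upwards [hGev] with w hw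
      rw [← hw]
      ring
    obtain ⟨j, rfl⟩ : ∃ j, k = j + 1 := ⟨k - 1, by omega⟩
    have hb : ∀ n : ℕ, n * ‖G 0‖ ≤ (1 + δ) / δ ^ (j + 1) := by
      intro n
      obtain ⟨K, hK, hK0, hKev⟩ := iterate_germ_eq_add hk hF h0 hG hFG n
      rw [← Complex.norm_natCast, ← norm_mul, ← hK0]
      refine norm_coeff_le (h := fun w => H n w - w) hδ ((hHd n).sub differentiableOn_id)
        (fun w hw => ?_) hK ?_
      · refine (norm_sub_le _ _).trans (add_le_add (hHb n w hw) ?_)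
        simpa using (mem_ball_zero_iff.mp hw).le
      · filter_upwards [hHF n, hKev] with w h1 h2
        rw [h1, h2]
        ring
    obtain ⟨n, hn⟩ := exists_nat_gt ((1 + δ) / δ ^ (j + 1) / ‖G 0‖)
    rw [div_lt_iff₀ (norm_pos_iff.mpr hG0)] at hn
    exact absurd (hb n) (not_le.mpr hn)

theorem eval_denom_ne_of_isRoot {R : RatFunc ℂ} {z : ℂ} (hz : (fixedPoly R).eval z = 0) :
    R.denom.eval z ≠ 0 := by
  intro h
  rcases eval_num_denom_ne R z with h' | h'
  · rw [fixedPoly, eval_sub, eval_mul, h, mul_zero, zero_sub, neg_eq_zero] at hz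
    exact h' hz
  · exact h' h

theorem hasMultiplier_coe {R : RatFunc ℂ} {z : ℂ} (hz : (fixedPoly R).eval z = 0) :
    HasMultiplier R z (1 - (derivative (fixedPoly R)).eval z / R.denom.eval z) := by
  have hQ := eval_denom_ne_of_isRoot hz
  have hP : R.num.eval z = z * R.denom.eval z := by
    rw [fixedPoly, eval_sub, eval_mul, eval_X, sub_eq_zero] at hz
    exact hz.symm
  obtain ⟨g, hm⟩ := exists_mobius_translate z
  have hQ0 : R.denom.eval (0 + z) ≠ 0 := by rwa [zero_add]
  have hshift : ∀ P : ℂ[X], HasDerivAt (fun w : ℂ => P.eval (w + z)) ((derivative P).eval z) 0 := by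
    intro P
    have := (P.hasDerivAt (0 + z)).comp (0 : ℂ) ((hasDerivAt_id 0).add_const z)
    rwa [mul_one, zero_add] at this
  have hder := ((hshift R.num).div (hshift R.denom) hQ0).sub_const z
  refine ⟨g, fun w => R.num.eval (w + z) / R.denom.eval (w + z) - z, by rw [hm, zero_add], ?_, ?_,
    hder.congr_deriv ?_, ?_⟩
  · have h1 : ∀ P : ℂ[X], AnalyticAt ℂ (fun w : ℂ => P.eval (w + z)) 0 := fun P =>
      (Differentiable.analyticAt (P.differentiable.comp (differentiable_id.add_const z)) 0)
    exact ((h1 _).div (h1 _) hQ0).sub analyticAt_const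
  · simp only [zero_add, hP, mul_div_cancel_right₀ _ hQ, sub_self]
  · simp only [zero_add, fixedPoly, derivative_sub, derivative_mul,
      derivative_X, one_mul, eval_sub, eval_add, eval_mul, eval_X, hP]
    field_simp
    ring
  · have hcont : ContinuousAt (fun w : ℂ => R.denom.eval (w + z)) 0 :=
      (R.denom.continuous.comp (continuous_id.add continuous_const)).continuousAt
    filter_upwards [hcont.eventually_ne hQ0] with w hw
    rw [hm, hm, sub_add_cancel, ratMap_coe, ratio_of_ne hw]

theorem hasDerivAt_homEval {d : ℕ} (hd : 1 ≤ d) (P : ℂ[X]) :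
    HasDerivAt (fun w => homEval d P 1 w) (P.coeff (d - 1)) 0 := by
  unfold homEval
  have h := HasDerivAt.fun_sum (u := Finset.range (d + 1)) (x := (0 : ℂ))
    (A := fun i w => P.coeff i * 1 ^ i * w ^ (d - i)) fun i _ =>
    ((hasDerivAt_id (0 : ℂ)).pow (d - i)).const_mul (P.coeff i * 1 ^ i)
  refine h.congr_deriv ?_
  rw [Finset.sum_eq_single (d - 1)]
  · have : d - (d - 1) = 1 := by omega
    simp [this]
  · intro i hi hne
    have := Finset.mem_range.mp hi
    rcases Nat.lt_or_ge i d with hlt | hge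
    · simp [zero_pow (show d - i - 1 ≠ 0 by omega)]
    · simp [show d - i = 0 by omega]
  · intro h
    exact absurd (Finset.mem_range.mpr (by omega)) h

theorem hasMultiplier_infty {R : RatFunc ℂ} (hR : 1 ≤ degree R)
    (h : R.denom.coeff (degree R) = 0) : HasMultiplier R OnePoint.infty
      (R.denom.coeff (degree R - 1) / R.num.coeff (degree R)) := by
  have hp : R.num.coeff (degree R) ≠ 0 := (coeff_degree_ne R).resolve_right (by simpa using h)
  obtain ⟨g, hm⟩ := exists_mobius_swap
  have hP0 : homEval (degree R) R.num 1 0 = R.num.coeff (degree R) := by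
    rw [homEval_zero_right, one_pow, mul_one]
  have hQ0 : homEval (degree R) R.denom 1 0 = 0 := by
    rw [homEval_zero_right, h, zero_mul]
  have ha : ∀ P : ℂ[X], AnalyticAt ℂ (fun w : ℂ => homEval (degree R) P 1 w) 0 := fun P =>
    analyticAt_homEval (degree R) P analyticAt_const analyticAt_id
  have hder := (hasDerivAt_homEval hR R.denom).div (hasDerivAt_homEval hR R.num) (by rwa [hP0])
  refine ⟨g, fun w => homEval (degree R) R.denom 1 w / homEval (degree R) R.num 1 w, ?_,
    (ha _).div (ha _) (by rwa [hP0]), by simp only [hQ0, zero_div], hder.congr_deriv ?_, ?_⟩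
  · rw [← ratio_one, hm _ _ (by simp), ratio_zero]
  · rw [hP0, hQ0]
    field_simp
    ring
  · have hcont : ContinuousAt (fun w : ℂ => homEval (degree R) R.num 1 w) 0 := (ha _).continuousAt
    filter_upwards [hcont.eventually_ne (by rwa [hP0])] with w hw
    rw [← ratio_one w, ← ratio_one (_ / _), hm _ _ (by simp), hm _ _ (by simp),
      ratMap_ratio R (by simp), ratio_eq_ratio_iff (by simp) (Or.inl hw)]
    field_simp

theorem half_le_re_inv {l : ℂ} (h : ‖l‖ ≤ 1) (h1 : l ≠ 1) : 1 / 2 ≤ ((1 - l)⁻¹).re := by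
  have hne : 1 - l ≠ 0 := sub_ne_zero.mpr h1.symm
  have hpos : 0 < Complex.normSq (1 - l) := Complex.normSq_pos.mpr hne
  have h2 : Complex.normSq l ≤ 1 := by
    rw [← Complex.sq_norm]
    nlinarith [norm_nonneg l]
  rw [Complex.inv_re, div_le_div_iff₀ two_pos hpos]
  rw [Complex.normSq_apply] at *
  simp only [Complex.sub_re, Complex.sub_im, Complex.one_re, Complex.one_im]
  nlinarith

/-- The residue theorem for `Q / D`, with `D` having only simple roots. -/
theorem coeff_eq_leadingCoeff_mul_sum {D Q : ℂ[X]} (hD : D ≠ 0)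
    (hs : ∀ z, D.eval z = 0 → (derivative D).eval z ≠ 0) (hQ : Q.natDegree < D.natDegree) :
    D.roots.toFinset.card = D.natDegree ∧ Q.coeff (D.natDegree - 1) =
      D.leadingCoeff * ∑ z ∈ D.roots.toFinset, Q.eval z / (derivative D).eval z := by
  have hsplit : D.Splits := IsAlgClosed.splits D
  have hnd : D.roots.Nodup := by
    rw [Multiset.nodup_iff_count_le_one]
    intro z
    rw [count_roots]
    by_contra! hlt
    rw [one_lt_rootMultiplicity_iff_isRoot hD] at hlt
    exact hs z hlt.1 hlt.2
  have hcard : D.roots.toFinset.card = D.natDegree := by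
    rw [Multiset.toFinset_card_of_nodup hnd, hsplit.natDegree_eq_card_roots]
  refine ⟨hcard, ?_⟩
  have hprod : D = C D.leadingCoeff * Lagrange.nodal D.roots.toFinset id := by
    conv_lhs => rw [hsplit.eq_prod_roots]
    rw [Lagrange.nodal, Finset.prod, Multiset.toFinset_val, hnd.dedup]
    rfl
  have hdeg : Q.degree < D.roots.toFinset.card := by
    rw [hcard]
    exact lt_of_le_of_lt degree_le_natDegree (by exact_mod_cast hQ)
  have hL := Lagrange.coeff_eq_sum (s := D.roots.toFinset) (v := id) (injOn_id _) hdeg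
  rw [hcard] at hL
  rw [hL, Finset.mul_sum]
  refine Finset.sum_congr rfl fun z hz => ?_
  have hder : (derivative D).eval z =
      D.leadingCoeff * ∏ j ∈ D.roots.toFinset.erase z, (id z - id j) := by
    conv_lhs => rw [hprod]
    rw [derivative_C_mul, eval_mul, eval_C]
    have := Lagrange.eval_nodal_derivative_eval_node_eq (v := id) hz
    rw [id] at this
    rw [this, Lagrange.eval_nodal]
    rfl
  have hlc := leadingCoeff_ne_zero.mpr hD
  rw [hder, ← mul_div_assoc, mul_div_mul_left _ _ hlc]
  rfl

/-- The multiplier of some fixed point is one or of modulus greater than one. Otherwise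
`∑ 1 / (1 - λ) = 1` over all fixed points, of which there are `degree R + 1`, although each term
has real part at least one half. -/
theorem exists_repelling_or_parabolic (R : RatFunc ℂ) (hR : 2 ≤ degree R) :
    (∃ z l, (fixedPoly R).eval z = 0 ∧
      l = 1 - (derivative (fixedPoly R)).eval z / R.denom.eval z ∧ (1 < ‖l‖ ∨ l = 1)) ∨
    (∃ l, R.denom.coeff (degree R) = 0 ∧
      l = R.denom.coeff (degree R - 1) / R.num.coeff (degree R) ∧ (1 < ‖l‖ ∨ l = 1)) := by
  by_contra! hcon
  obtain ⟨hfin, hinf⟩ := hcon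
  have hD : fixedPoly R ≠ 0 := fixedPoly_ne_zero R hR
  have hfin' : ∀ z, (fixedPoly R).eval z = 0 →
      ‖1 - (derivative (fixedPoly R)).eval z / R.denom.eval z‖ ≤ 1 ∧
      1 - (derivative (fixedPoly R)).eval z / R.denom.eval z ≠ 1 := fun z hz => hfin z _ hz rfl
  have hs : ∀ z, (fixedPoly R).eval z = 0 → (derivative (fixedPoly R)).eval z ≠ 0 := by
    intro z hz h
    exact (hfin' z hz).2 (by rw [h, zero_div, sub_zero])
  have hterm : ∀ z, (fixedPoly R).eval z = 0 →
      1 / 2 ≤ (R.denom.eval z / (derivative (fixedPoly R)).eval z).re := by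
    intro z hz
    have := half_le_re_inv (hfin' z hz).1 (hfin' z hz).2
    rwa [sub_sub_cancel, inv_div] at this
  have hcoeff : ∀ n, (fixedPoly R).coeff (n + 1) = R.denom.coeff n - R.num.coeff (n + 1) := by
    intro n
    rw [fixedPoly, coeff_sub, coeff_X_mul]
  have hnum0 : R.num.coeff (degree R + 1) = 0 :=
    coeff_eq_zero_of_natDegree_lt (Nat.lt_succ_of_le (natDegree_num_le R))
  have hdegle : (fixedPoly R).natDegree ≤ degree R + 1 := by
    refine (natDegree_sub_le _ _).trans (max_le (natDegree_mul_le.trans ?_) ?_)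
    · rw [natDegree_X, add_comm]
      exact Nat.succ_le_succ (natDegree_denom_le R)
    · exact (natDegree_num_le R).trans (Nat.le_succ _)
  have hsum : (((fixedPoly R).roots.toFinset.card : ℝ) * (1 / 2) ≤
      (∑ z ∈ (fixedPoly R).roots.toFinset,
        R.denom.eval z / (derivative (fixedPoly R)).eval z).re) := by
    rw [Complex.re_sum, ← nsmul_eq_mul]
    refine Finset.card_nsmul_le_sum _ _ _ fun z hz => hterm z ?_
    exact (mem_roots'.mp (Multiset.mem_toFinset.mp hz)).2
  have hR' : (2 : ℝ) ≤ degree R := by exact_mod_cast hR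
  rcases eq_or_ne (R.denom.coeff (degree R)) 0 with hq | hq
  · obtain ⟨hn, h1⟩ := hinf _ hq rfl
    have hp : R.num.coeff (degree R) ≠ 0 := (coeff_degree_ne R).resolve_right (by simpa using hq)
    set q := R.denom.coeff (degree R - 1) with hqdef
    set p := R.num.coeff (degree R) with hpdef
    have hqp : q - p ≠ 0 := fun h => h1 (by rw [sub_eq_zero.mp h, div_self hp])
    have hcd : (fixedPoly R).coeff (degree R) = q - p := by
      have := hcoeff (degree R - 1)
      rwa [show degree R - 1 + 1 = degree R by omega] at this
    have hdeg : (fixedPoly R).natDegree = degree R := by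
      refine le_antisymm (Nat.le_of_lt_succ (lt_of_le_of_ne hdegle fun h => ?_)) ?_
      · have := leadingCoeff_ne_zero.mpr hD
        rw [leadingCoeff, h, hcoeff, hq, hnum0, sub_zero] at this
        exact this rfl
      · exact le_natDegree_of_ne_zero (by rwa [hcd])
    have hQdeg : R.denom.natDegree < (fixedPoly R).natDegree := by
      rw [hdeg]
      refine lt_of_le_of_ne (natDegree_denom_le R) fun h => ?_
      have := leadingCoeff_ne_zero.mpr R.denom_ne_zero
      rw [leadingCoeff, h] at this
      exact this hq
    obtain ⟨hcard, hres⟩ := coeff_eq_leadingCoeff_mul_sum hD hs hQdeg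
    rw [hcard, hdeg] at hsum
    rw [leadingCoeff, hdeg, hcd, ← hqdef] at hres
    set σ := ∑ z ∈ (fixedPoly R).roots.toFinset,
        R.denom.eval z / (derivative (fixedPoly R)).eval z
    have htot : σ + (1 - q / p)⁻¹ = 1 := by
      have h3 : 1 - q / p ≠ 0 := sub_ne_zero.mpr h1.symm
      have h4 : (1 - q / p)⁻¹ = -(p / (q - p)) := by
        rw [inv_eq_iff_eq_inv]
        field_simp
        ring
      have h5 : σ = q / (q - p) := by
        rw [eq_div_iff hqp, mul_comm, ← hres]
      rw [h4, h5]
      field_simp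
      ring
    have h6 := congrArg Complex.re htot
    rw [Complex.add_re, Complex.one_re] at h6
    have := half_le_re_inv hn h1
    linarith
  · have hcd : (fixedPoly R).coeff (degree R + 1) = R.denom.coeff (degree R) := by
      rw [hcoeff, hnum0, sub_zero]
    have hdeg : (fixedPoly R).natDegree = degree R + 1 :=
      le_antisymm hdegle (le_natDegree_of_ne_zero (by rwa [hcd]))
    have hQdeg : R.denom.natDegree < (fixedPoly R).natDegree := by
      rw [hdeg]
      exact Nat.lt_succ_of_le (natDegree_denom_le R)
    obtain ⟨hcard, hres⟩ := coeff_eq_leadingCoeff_mul_sum hD hs hQdeg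
    rw [hcard, hdeg] at hsum
    rw [leadingCoeff, hdeg, hcd, Nat.add_sub_cancel] at hres
    have h5 := mul_left_cancel₀ hq ((mul_one _).trans hres)
    rw [← h5, Complex.one_re] at hsum
    push_cast at hsum
    linarith

/-- There is a fixed point in the Julia set which has another preimage. -/
theorem exists_fixed_mem_julia (R : RatFunc ℂ) (hR : 2 ≤ degree R) :
    ∃ x ∈ julia R, ratMap R x = x ∧ ∃ y ≠ x, ratMap R y = x := by
  have hl0 : ∀ l : ℂ, (1 < ‖l‖ ∨ l = 1) → l ≠ 0 := by
    rintro l (h | h) rfl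
    · simp at h
      linarith
    · exact zero_ne_one h
  rcases exists_repelling_or_parabolic R hR with ⟨z, l, hz, hl, hlc⟩ | ⟨l, hq, hl, hlc⟩
  · have hm := hasMultiplier_coe hz
    rw [← hl] at hm
    refine ⟨z, hm.mem_julia hR hlc, hm.fixed, ?_⟩
    by_contra! hcon
    refine hl0 l hlc ?_
    -- the only preimage is a root of full multiplicity of `P - z Q`
    set W := R.num - C z * R.denom with hW
    have hWd : W.coeff (degree R) ≠ 0 := by
      rw [hW, coeff_sub, coeff_C_mul]
      intro h
      refine hcon OnePoint.infty (OnePoint.infty_ne_coe z) ?_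
      rw [ratMap_infty, ← ratio_one z, ratio_eq_ratio_iff (coeff_degree_ne R) (by simp)]
      linear_combination h
    have hW0 : W ≠ 0 := fun h => hWd (by rw [h, coeff_zero])
    have hdeg : degree R ≤ W.natDegree := le_natDegree_of_ne_zero hWd
    have hroots : ∀ w ∈ W.roots, z = w := by
      intro w hw
      have hw := (mem_roots'.mp hw).2
      rw [IsRoot, hW, eval_sub, eval_mul, eval_C] at hw
      by_contra hne
      refine hcon w (fun h => hne (OnePoint.coe_injective h).symm) ?_
      rw [ratMap_coe, ← ratio_one z, ratio_eq_ratio_iff (eval_num_denom_ne R w) (by simp)]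
      linear_combination hw
    have hmult : 1 < W.rootMultiplicity z := by
      rw [← count_roots, Multiset.count_eq_card.mpr hroots,
        ← (IsAlgClosed.splits W).natDegree_eq_card_roots]
      omega
    have hder := ((one_lt_rootMultiplicity_iff_isRoot hW0).mp hmult).2
    rw [IsRoot, hW, derivative_sub, derivative_C_mul, eval_sub, eval_mul, eval_C] at hder
    have hQ := eval_denom_ne_of_isRoot hz
    rw [hl, sub_eq_zero, eq_div_iff hQ]
    simp only [fixedPoly, derivative_sub, derivative_mul, derivative_X, one_mul, eval_sub, eval_add,
      eval_mul, eval_X]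
    linear_combination hder
  · have hm := hasMultiplier_infty (by omega) hq
    rw [← hl] at hm
    refine ⟨OnePoint.infty, hm.mem_julia hR hlc, hm.fixed, ?_⟩
    by_contra! hcon
    refine hl0 l hlc ?_
    have hdeg : R.denom.natDegree = 0 := by
      by_contra hne
      obtain ⟨w, hw⟩ := IsAlgClosed.exists_root R.denom fun h =>
        hne (natDegree_eq_zero_iff_degree_le_zero.mpr h.le)
      refine hcon w (OnePoint.coe_ne_infty w) ?_
      rw [ratMap_coe, hw, ratio_zero]
    rw [hl, coeff_eq_zero_of_natDegree_lt (by omega), zero_div]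

/-- A backward invariant set containing a fixed point with another preimage is infinite. -/
theorem infinite_of_backward_invariant {X : Type*} {f : X → X} (hf : Function.Surjective f)
    {T : Set X} (hT : f ⁻¹' T ⊆ T) {x y : X} (hx : x ∈ T) (hfx : f x = x) (hy : y ≠ x)
    (hfy : f y = x) : T.Infinite := by
  intro hfin
  have : Finite T := hfin
  -- a section of `f` maps `T` to itself, hence onto itself, so that `f` is injective on `T`
  choose σ hσ using hf
  let s : T → T := fun t => ⟨σ t, hT (by rw [mem_preimage, hσ]; exact t.2)⟩
  have hinj : Function.Injective s := by
    intro a b hab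
    have h := congrArg (fun t : T => f t) hab
    simp only [s, hσ] at h
    exact Subtype.ext h
  have hsurj := Finite.surjective_of_injective hinj
  have hyT : y ∈ T := hT (by rwa [mem_preimage, hfy])
  obtain ⟨a, ha⟩ := hsurj ⟨x, hx⟩
  obtain ⟨b, hb⟩ := hsurj ⟨y, hyT⟩
  have ha' : σ a = x := congrArg Subtype.val ha
  have hb' : σ b = y := congrArg Subtype.val hb
  have h1 : (a : X) = x := by rw [← hσ a, ha', hfx]
  have h2 : (b : X) = x := by rw [← hσ b, hb', hfy]
  exact hy (by rw [← ha', ← hb', h1, h2])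

end

noncomputable section

/-! ### Density of backward orbits -/

theorem iterate_notMem_of_preimage_subset {X : Type*} {f : X → X} {T : Set X} (hT : f ⁻¹' T ⊆ T)
    {x : X} (hx : x ∉ T) (n : ℕ) : f^[n] x ∉ T := by
  induction n with
  | zero => exact hx
  | succ n ih =>
    rw [Function.iterate_succ_apply']
    exact fun h => ih (hT h)

/-- An open set whose iterated images avoid three points lies in the Fatou set. -/
theorem mem_fatou_of_omits (R : RatFunc ℂ) {U : Set Sphere} (hU : IsOpen U) {p q r : Sphere}
    (hpq : p ≠ q) (hpr : p ≠ r) (hqr : q ≠ r) (hp : ∀ n, ∀ y ∈ U, (ratMap R)^[n] y ≠ p)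
    (hq : ∀ n, ∀ y ∈ U, (ratMap R)^[n] y ≠ q) (hr : ∀ n, ∀ y ∈ U, (ratMap R)^[n] y ≠ r)
    {x : Sphere} (hx : x ∈ U) : x ∈ fatou R := by
  obtain ⟨M, hMp, hMq, hMr⟩ := exists_mobius_three hpq hpr hqr
  obtain ⟨g, hg⟩ := exists_mobius_zero x
  have hemb := mobius_coe_isOpenEmbedding g
  set c : ℂ → Sphere := fun w => mobius g (w : Sphere) with hc
  have hc0 : c 0 = x := hg
  obtain ⟨ρ, hρ, hρU⟩ := Metric.mem_nhds_iff.mp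
    (hemb.continuous.continuousAt.preimage_mem_nhds (hU.mem_nhds (by rwa [← hc0] at hx)))
  set f : ℕ → ℂ → ℂ := fun n w => toPlane (mobius M ((ratMap R)^[n] (c w))) with hf
  have hfin : ∀ n, ∀ w ∈ Metric.ball (0 : ℂ) ρ, mobius M ((ratMap R)^[n] (c w)) ≠ ratio 1 0 :=
    fun n w hw h => hr n _ (hρU hw) ((mobius M).injective (h.trans hMr.symm))
  have hfc : ∀ n, ∀ w ∈ Metric.ball (0 : ℂ) ρ,
      (f n w : Sphere) = mobius M ((ratMap R)^[n] (c w)) := fun n w hw => coe_toPlane (hfin n w hw)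
  have hfd : ∀ n, DifferentiableOn ℂ (f n) (Metric.ball 0 ρ) := fun n w hw =>
    (HoloAt.analyticAt ((((holoAt_coe w).mobius g).iterate_ratMap R n).mobius M)
      (hfin n w hw)).differentiableAt.differentiableWithinAt
  have hf0 : ∀ n, ∀ w ∈ Metric.ball (0 : ℂ) ρ, f n w ≠ 0 := by
    intro n w hw h
    refine hp n _ (hρU hw) ((mobius M).injective ?_)
    rw [hMp, ← hfc n w hw, h, ratio_one]
  have hf1 : ∀ n, ∀ w ∈ Metric.ball (0 : ℂ) ρ, f n w ≠ 1 := by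
    intro n w hw h
    refine hq n _ (hρU hw) ((mobius M).injective ?_)
    rw [hMq, ← hfc n w hw, h, ratio_one]
  have hsub : Metric.ball (0 : ℂ) (ρ / 4) ⊆ Metric.ball 0 ρ := Metric.ball_subset_ball (by linarith)
  have hlip : ∀ n, ∀ z ∈ Metric.ball (0 : ℂ) (ρ / 4), ∀ w ∈ Metric.ball (0 : ℂ) (ρ / 4),
      dist (f n z : Sphere) (f n w) ≤ (2 * (2000 / ρ) + 1) * dist z w := fun n z hz w hw =>
    dist_coe_le_of_norm_deriv_le
      (fun v hv => (hfd n).differentiableAt (Metric.isOpen_ball.mem_nhds (hsub hv)))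
      (fun v hv => norm_deriv_le_of_omits (hfd n) (hf0 n) (hf1 n) hv) hz hw
  rw [mem_fatou_iff]
  have himg : c '' Metric.ball 0 (ρ / 4) ∈ 𝓝 x := by
    rw [← hc0]
    exact hemb.isOpenMap.image_mem_nhds (Metric.ball_mem_nhds 0 (by positivity))
  filter_upwards [himg]
  rintro _ ⟨z, hz, rfl⟩
  rw [Metric.equicontinuousAt_iff_right]
  intro ε hε
  obtain ⟨δ, hδ, hd⟩ := Metric.uniformContinuous_iff.mp
    (CompactSpace.uniformContinuous_of_continuous (mobius M).symm.continuous) ε hε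
  rw [← hemb.map_nhds_eq, eventually_map]
  have hcont : Tendsto (fun w => (2 * (2000 / ρ) + 1) * dist z w) (𝓝 z) (𝓝 0) := by
    have : Continuous fun w => (2 * (2000 / ρ) + 1) * dist z w := by fun_prop
    simpa using this.tendsto z
  filter_upwards [hcont.eventually_lt_const hδ, Metric.isOpen_ball.mem_nhds hz] with w hw hwb n
  have h1 := hd ((hlip n z hz w hwb).trans_lt hw)
  rwa [hfc n z (hsub hz), hfc n w (hsub hwb), Homeomorph.symm_apply_apply,
    Homeomorph.symm_apply_apply] at h1

theorem julia_subset_closure (R : RatFunc ℂ) {T : Set Sphere} (hT : ratMap R ⁻¹' T ⊆ T)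
    (hinf : T.Infinite) : julia R ⊆ closure T := by
  intro x hx
  by_contra hcl
  refine hx ?_
  obtain ⟨p, hp⟩ := hinf.nonempty
  obtain ⟨q, hq, hqp⟩ := (hinf.sdiff (finite_singleton p)).nonempty
  obtain ⟨r, hr, hrpq⟩ := (hinf.sdiff (toFinite {p, q})).nonempty
  simp only [mem_singleton_iff, mem_insert_iff, not_or] at hqp hrpq
  have hav : ∀ t ∈ T, ∀ n, ∀ y ∈ (closure T)ᶜ, (ratMap R)^[n] y ≠ t := fun t ht n y hy h =>
    iterate_notMem_of_preimage_subset hT (fun hyT => hy (subset_closure hyT)) n (h ▸ ht)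
  exact mem_fatou_of_omits R isClosed_closure.isOpen_compl (Ne.symm hqp) (Ne.symm hrpq.1)
    (Ne.symm hrpq.2) (hav p hp) (hav q hq) (hav r hr) hcl

/-! ### The tower -/

theorem one_mem_juliaPeriods (R : RatFunc ℂ) (hR : 2 ≤ degree R) : 1 ∈ juliaPeriods R := by
  obtain ⟨x, hx, hfx, -⟩ := exists_fixed_mem_julia R hR
  exact ⟨one_pos, x, hx, hfx⟩

theorem lowestPeriod_eq_one (R : RatFunc ℂ) (hR : 2 ≤ degree R) : lowestPeriod R = 1 :=
  le_antisymm (Nat.sInf_le (one_mem_juliaPeriods R hR))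
    (Nat.sInf_mem ⟨1, one_mem_juliaPeriods R hR⟩).1

theorem mem_tower_zero (R : RatFunc ℂ) (hR : 2 ≤ degree R) (x : Sphere) :
    x ∈ tower R 0 ↔ x ∈ julia R ∧ ratMap R x = x := by
  change x ∈ julia R ∧ Function.IsPeriodicPt (ratMap R) (lowestPeriod R) x ↔ _
  rw [lowestPeriod_eq_one R hR]
  rfl

theorem mem_tower_succ (R : RatFunc ℂ) (n : ℕ) (x : Sphere) :
    x ∈ tower R (n + 1) ↔ ratMap R x ∈ tower R n ∨ x ∈ tower R n := Iff.rfl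

theorem tower_subset_julia (R : RatFunc ℂ) (hR : 2 ≤ degree R) (n : ℕ) : tower R n ⊆ julia R := by
  induction n with
  | zero => exact fun x hx => hx.1
  | succ n ih =>
    rintro x (hx | hx)
    · exact (ratMap_mem_julia_iff R (by omega) x).mp (ih hx)
    · exact ih hx

theorem finite_tower (R : RatFunc ℂ) (hR : 2 ≤ degree R) (n : ℕ) : (tower R n).Finite := by
  induction n with
  | zero => exact (finite_fixedPoints R hR).subset fun x hx => ((mem_tower_zero R hR x).mp hx).2
  | succ n ih => exact (ih.preimage' fun w _ => finite_fibre R (by omega) w).union ih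

theorem closure_iUnion_tower (R : RatFunc ℂ) (hR : 2 ≤ degree R) :
    closure (⋃ n, tower R n) = julia R := by
  have hback : ratMap R ⁻¹' (⋃ n, tower R n) ⊆ ⋃ n, tower R n := by
    intro x hx
    obtain ⟨n, hn⟩ := mem_iUnion.mp hx
    exact mem_iUnion.mpr ⟨n + 1, Or.inl hn⟩
  obtain ⟨x, hx, hfx, y, hy, hfy⟩ := exists_fixed_mem_julia R hR
  refine Subset.antisymm (closure_minimal (iUnion_subset (tower_subset_julia R hR))
    (isClosed_julia R)) (julia_subset_closure R hback ?_)
  exact infinite_of_backward_invariant (surjective_ratMap R (by omega)) hback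
    (mem_iUnion.mpr ⟨0, (mem_tower_zero R hR x).mpr ⟨hx, hfx⟩⟩) hfx hy hfy

/-! ### The action of the centralizer on the tower -/

theorem centralizer_apply_ratMap {R : RatFunc ℂ} (g : juliaCentralizer R) (x : julia R) :
    ((g : julia R ≃ₜ julia R) (juliaMap R x) : Sphere) =
      ratMap R ((g : julia R ≃ₜ julia R) x : julia R) :=
  congrArg Subtype.val (congrFun g.2 x)

theorem centralizer_mem_tower_iff {R : RatFunc ℂ} (hR : 2 ≤ degree R) (g : juliaCentralizer R)
    (n : ℕ) (x : julia R) :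
    (((g : julia R ≃ₜ julia R) x : julia R) : Sphere) ∈ tower R n ↔ (x : Sphere) ∈ tower R n := by
  induction n generalizing x with
  | zero =>
    rw [mem_tower_zero R hR, mem_tower_zero R hR, and_iff_right (Subtype.coe_prop _),
      and_iff_right x.2, ← centralizer_apply_ratMap, Subtype.coe_inj,
      (g : julia R ≃ₜ julia R).injective.eq_iff, ← Subtype.coe_inj]
    rfl
  | succ n ih =>
    rw [mem_tower_succ, mem_tower_succ, ih, ← centralizer_apply_ratMap, ih]
    rfl

/-- The action of the centralizer by permutations of a set of the tower. -/
def towerAction {R : RatFunc ℂ} (hR : 2 ≤ degree R) (n : ℕ) :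
    juliaCentralizer R →* towerPerm (tower R) n where
  toFun g :=
    ⟨{ toFun := fun x => ⟨(g : julia R ≃ₜ julia R) ⟨x, tower_subset_julia R hR n x.2⟩,
        (centralizer_mem_tower_iff hR g n _).mpr x.2⟩
       invFun := fun x => ⟨((g⁻¹ : juliaCentralizer R) : julia R ≃ₜ julia R)
          ⟨x, tower_subset_julia R hR n x.2⟩, (centralizer_mem_tower_iff hR g⁻¹ n _).mpr x.2⟩
       left_inv := fun x => by
         have h := congrArg Subtype.val
           ((g : julia R ≃ₜ julia R).symm_apply_apply ⟨x, tower_subset_julia R hR n x.2⟩)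
         exact Subtype.ext h
       right_inv := fun x => by
         have h := congrArg Subtype.val
           ((g : julia R ≃ₜ julia R).apply_symm_apply ⟨x, tower_subset_julia R hR n x.2⟩)
         exact Subtype.ext h },
      fun k _ _ => centralizer_mem_tower_iff hR g k _⟩
  map_one' := rfl
  map_mul' _ _ := rfl

theorem continuous_centralizer_apply {R : RatFunc ℂ} (x : julia R) :
    Continuous fun g : juliaCentralizer R => (((g : julia R ≃ₜ julia R) x : julia R) : Sphere) := by
  have h : Continuous fun f : julia R ≃ₜ julia R => (⟨f, f.continuous⟩ : C(julia R, julia R)) :=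
    continuous_induced_dom
  exact continuous_subtype_val.comp
    ((continuous_eval_const (F := C(julia R, julia R)) x).comp (h.comp continuous_subtype_val))

theorem continuous_towerAction {R : RatFunc ℂ} (hR : 2 ≤ degree R) (n : ℕ) :
    Continuous (towerAction hR n) := by
  have hfin := finite_tower R hR n
  have : Finite (tower R n) := hfin
  rw [continuous_discrete_rng]
  intro σ
  have heq : towerAction hR n ⁻¹' {σ} = ⋂ x : tower R n, {g : juliaCentralizer R |
      (((g : julia R ≃ₜ julia R) ⟨x, tower_subset_julia R hR n x.2⟩ : julia R) : Sphere) ∈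
        (tower R n \ {(((σ : Equiv.Perm (tower R n)) x : tower R n) : Sphere)})ᶜ} := by
    ext g
    simp only [mem_preimage, mem_singleton_iff, mem_iInter, mem_ofPred_eq, mem_compl_iff,
      Set.mem_sdiff, not_and_not_right]
    constructor
    · rintro rfl x -
      rfl
    · intro h
      refine Subtype.ext (Equiv.ext fun x => Subtype.ext (h x ?_))
      exact (centralizer_mem_tower_iff hR g n _).mpr x.2
  rw [heq]
  exact isOpen_iInter_of_finite fun x =>
    (hfin.sdiff).isClosed.isOpen_compl.preimage (continuous_centralizer_apply _)

/-- The homomorphism from the centralizer to the inverse limit given by restriction. -/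
def restrictToTower {R : RatFunc ℂ} (hR : 2 ≤ degree R) : juliaCentralizer R →* cantorGroup R where
  toFun g := ⟨fun n => towerAction hR n g, fun _ _ _ => rfl⟩
  map_one' := rfl
  map_mul' _ _ := rfl

theorem continuous_restrictToTower {R : RatFunc ℂ} (hR : 2 ≤ degree R) :
    Continuous (restrictToTower hR) :=
  (continuous_pi fun n => continuous_towerAction hR n).subtype_mk _

theorem injective_restrictToTower {R : RatFunc ℂ} (hR : 2 ≤ degree R) :
    Function.Injective (restrictToTower hR) := by
  intro g h hgh
  have hn : ∀ n, towerAction hR n g = towerAction hR n h := fun n =>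
    congrFun (congrArg Subtype.val hgh) n
  have hdense : Dense {x : julia R | (x : Sphere) ∈ ⋃ n, tower R n} := by
    rw [Subtype.dense_iff]
    intro x hx
    have himg : Subtype.val '' {x : julia R | (x : Sphere) ∈ ⋃ n, tower R n} =
        ⋃ n, tower R n := by
      refine Subset.antisymm (by rintro _ ⟨y, hy, rfl⟩; exact hy) fun y hy => ?_
      exact ⟨⟨y, iUnion_subset (tower_subset_julia R hR) hy⟩, hy, rfl⟩
    rw [himg, closure_iUnion_tower R hR]
    exact hx
  refine Subtype.ext (Homeomorph.ext fun x => congrFun (Continuous.ext_on hdense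
    (g : julia R ≃ₜ julia R).continuous (h : julia R ≃ₜ julia R).continuous ?_) x)
  intro y hy
  obtain ⟨n, hy⟩ := mem_iUnion.mp hy
  have := congrArg (fun σ : towerPerm (tower R) n =>
    (((σ : Equiv.Perm (tower R n)) ⟨y, hy⟩ : tower R n) : Sphere)) (hn n)
  exact Subtype.ext this

theorem totallyDisconnectedSpace_of_injective {X Y : Type*} [TopologicalSpace X]
    [TopologicalSpace Y] [TotallyDisconnectedSpace Y] {f : X → Y} (hf : Continuous f)
    (hi : Function.Injective f) : TotallyDisconnectedSpace X :=
  ⟨isTotallyDisconnected_of_image hf.continuousOn hi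
    (isTotallyDisconnected_of_totallyDisconnectedSpace _)⟩

/-- Two conjugacies from `R` to another rational map differ on the Julia set by a unique element
of the centralizer. -/
theorem existsUnique_centralizer {R S : RatFunc ℂ} (φ ψ : Sphere ≃ₜ Sphere)
    (hφ : ⇑φ ∘ ratMap R = ratMap S ∘ ⇑φ) (hψ : ⇑ψ ∘ ratMap R = ratMap S ∘ ⇑ψ) :
    ∃! g : juliaCentralizer R, ∀ x : julia R,
      φ x = ψ ((g : julia R ≃ₜ julia R) x : julia R) := by
  have hφJ := image_julia_of_semiconj φ hφ
  have hψJ := image_julia_of_semiconj ψ hψ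
  have hmem : ∀ x, x ∈ julia R ↔ (φ.trans ψ.symm) x ∈ julia R := by
    intro x
    rw [← φ.injective.mem_set_image, hφJ, ← hψJ,
      ← ψ.injective.mem_set_image (a := (φ.trans ψ.symm) x), Homeomorph.trans_apply,
      ψ.apply_symm_apply]
  let g : julia R ≃ₜ julia R := (φ.trans ψ.symm).subtype hmem
  have hg : ∀ x : julia R, φ x = ψ (g x : julia R) := fun x => (ψ.apply_symm_apply (φ x)).symm
  have hgc : g ∈ juliaCentralizer R := by
    funext x
    refine Subtype.ext (ψ.injective ?_)
    have h1 := congrFun hφ x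
    have h2 := congrFun hψ (g x)
    simp only [Function.comp_apply] at h1 h2 ⊢
    rw [← hg]
    change φ (ratMap R x) = ψ (ratMap R (g x))
    rw [h1, h2, ← hg]
  refine ⟨⟨g, hgc⟩, hg, fun k hk => Subtype.ext (Homeomorph.ext fun x => Subtype.ext ?_)⟩
  exact ψ.injective ((hk x).symm.trans (hg x))

end

end RationalDynamics

theorem proposition2p7p1 (R : RatFunc ℂ) (hR : 2 ≤ degree R) :
    -- there are periodic points in the Julia set, so the lowest period is a genuine one
    IsLeast (juliaPeriods R) (lowestPeriod R) ∧
    -- the sets of the tower are nonempty finite subsets of the Julia set, with dense union in it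
    (∀ n, (tower R n).Nonempty ∧ (tower R n).Finite ∧ tower R n ⊆ julia R) ∧
    closure (⋃ n, tower R n) = julia R ∧
    -- the permutation groups of the tower form an inverse system of finite groups, whose inverse
    -- limit is a totally disconnected topological group
    InverseSystem
      (fun ⦃n m : ℕ⦄ (h : n ≤ m) => ⇑(towerRestrict (tower_mono R) h)) ∧
    (∀ n, Finite (towerPerm (tower R) n)) ∧
    IsTopologicalGroup (cantorGroup R) ∧
    TotallyDisconnectedSpace (cantorGroup R) ∧
    -- restriction to the tower is a continuous injective homomorphism into this inverse limit
    (∃ Φ : juliaCentralizer R →* cantorGroup R,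
      Continuous Φ ∧ Function.Injective Φ ∧
      ∀ (g : juliaCentralizer R) (n : ℕ) (x : Sphere) (hx : x ∈ tower R n) (hJ : x ∈ julia R),
        ((((Φ g : ∀ n, towerPerm (tower R) n) n : Equiv.Perm (tower R n)) ⟨x, hx⟩ : tower R n) :
            Sphere) =
          ((g : julia R ≃ₜ julia R) ⟨x, hJ⟩ : julia R)) ∧
    -- a topological conjugacy from `R` to `S` is unique on the Julia set up to an element of the
    -- centralizer, which is totally disconnected
    TotallyDisconnectedSpace (juliaCentralizer R) ∧
    (∀ (S : RatFunc ℂ) (φ ψ : Sphere ≃ₜ Sphere),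
      ⇑φ ∘ ratMap R = ratMap S ∘ ⇑φ → ⇑ψ ∘ ratMap R = ratMap S ∘ ⇑ψ →
        φ '' julia R = julia S ∧ ψ '' julia R = julia S ∧
        ∃! g : juliaCentralizer R, ∀ x : julia R,
          φ x = ψ ((g : julia R ≃ₜ julia R) x : julia R)) := by

  refine ⟨⟨?_, fun n hn => Nat.sInf_le hn⟩, fun n => ⟨?_, finite_tower R hR n,
    tower_subset_julia R hR n⟩, closure_iUnion_tower R hR, ⟨fun _ _ => rfl, fun _ _ _ _ _ _ => rfl⟩,
    fun n => ?_, inferInstance, inferInstance, ⟨restrictToTower hR, continuous_restrictToTower hR,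
      injective_restrictToTower hR, fun _ _ _ _ _ => rfl⟩,
    totallyDisconnectedSpace_of_injective (continuous_restrictToTower hR)
      (injective_restrictToTower hR),
    fun S φ ψ hφ hψ => ⟨image_julia_of_semiconj φ hφ, image_julia_of_semiconj ψ hψ,
      existsUnique_centralizer φ ψ hφ hψ⟩⟩
  · exact Nat.sInf_mem ⟨1, one_mem_juliaPeriods R hR⟩
  · obtain ⟨x, hx, hfx, -⟩ := exists_fixed_mem_julia R hR
    exact ⟨x, tower_mono R (Nat.zero_le n) ((mem_tower_zero R hR x).mpr ⟨hx, hfx⟩)⟩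
  · have : Finite (tower R n) := finite_tower R hR n
    infer_instance
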